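/- Let $V:(0,\infty)\to\mathbb C^{n\times n}$ be Lebesgue measurable with $V(x)=V(x)^\dagger$ for all $x>0$ and $\int_0^\infty\|V(x)\|\,dx<\infty$, and let $A,B\in\mathbb C^{n\times n}$ satisfy $-B^\dagger A+A^\dagger B=0$ and $A^\dagger A+B^\dagger B>0$. Solutions of $$-\psi''+V(x)\psi=k^2\psi \qquad (*)$$ on the half line are understood as $n\times n$ matrix functions that are differentiable on $[0,\infty)$ (one-sidedly at $0$), whose derivative is locally absolutely continuous on $[0,\infty)$, and that satisfy $(*)$ almost everywhere. For $\operatorname{Im}k\ge 0$, $k\neq0$, let $f(k,x)$ be the Jost solution, i.e. the solution of $(*)$ with $f(k,x)=e^{ikx}[I+o(1)]$ and $f'(k,x)=ik\,e^{ikx}[I+o(1)]$ as $x\to+\infty$, and let $\varphi_{A,B}(k,x)$ be the solution of $(*)$ with $\varphi_{A,B}(k,0)=A$, $\varphi_{A,B}'(k,0)=B$. Put $$J_{A,B}(k)=f(-k^*,x)^\dagger\,\varphi_{A,B}'(k,x)-\big(f(-k^*,x)^\dagger\big)'\varphi_{A,B}(k,x),$$ which does not depend on $x$ and is evaluated at $x=0$,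 and, for real $k\ne0$, $$\psi_{A,B}(k,x)=-ik\,\varphi_{A,B}(k,x)\,J_{A,B}(k)^{-1},\qquad S_{A,B}(k)=-J_{A,B}(-k)\,J_{A,B}(k)^{-1}.$$ Let $J_{0,A,B}$, $\psi_{0,A,B}$, $S_{0,A,B}$ denote the same objects for $V\equiv0$. Then, for every real $k\neq0$, the matrices $J_{0,A,B}(k)$ and $J_{A,B}(k)$ are invertible, the function $x\mapsto\psi_{0,A,B}(k,x)\,V(x)\,\psi_{A,B}(k,x)$ is integrable on $(0,\infty)$, and $$S_{A,B}(k)=S_{0,A,B}(k)-\frac{2i}{k}\int_0^\infty\psi_{0,A,B}(k,x)\,V(x)\,\psi_{A,B}(k,x)\,dx .$$ -/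

import Mathlib

open Set Filter Topology MeasureTheory
-- The norm on matrices is the operator norm on `ℂⁿ` with its Euclidean norm.
open scoped Matrix Matrix.Norms.L2Operator ComplexOrder

namespace MatrixSchrodinger

noncomputable section

/-- The derivative `u'` of a function on the closed half line `[0, ∞)`, one-sided at `0`. -/
def halfDeriv {n : ℕ} (u : ℝ → Matrix (Fin n) (Fin n) ℂ) (x : ℝ) :
    Matrix (Fin n) (Fin n) ℂ :=
  derivWithin u (Ici 0) x

/-- `u` solves `-u'' + V u = k² u` on the half line, for a merely integrable `V`, in the usual
(Carathéodory) sense: `u` is differentiable on `[0, ∞)` and `u'` is an indefinite integral of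
`V u - k² u`, that is, `u'` is locally absolutely continuous on `[0, ∞)` and the equation holds
almost everywhere. Only the values of `u` on `[0, ∞)` matter. -/
structure IsSolution {n : ℕ} (V : ℝ → Matrix (Fin n) (Fin n) ℂ) (k : ℂ)
    (u : ℝ → Matrix (Fin n) (Fin n) ℂ) : Prop where
  differentiableOn : DifferentiableOn ℝ u (Ici 0)
  halfDeriv_eq : ∀ x, 0 ≤ x →
    halfDeriv u x = halfDeriv u 0 + ∫ t in (0 : ℝ)..x, (V t * u t - k ^ 2 • u t)

/-- `u` is the Jost solution at `k`: it solves the equation and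
`u(x) = e^{ikx} (I + o(1))`, `u'(x) = i k e^{ikx} (I + o(1))` as `x → ∞`. -/
structure IsJostSolution {n : ℕ} (V : ℝ → Matrix (Fin n) (Fin n) ℂ) (k : ℂ)
    (u : ℝ → Matrix (Fin n) (Fin n) ℂ) : Prop where
  isSolution : IsSolution V k u
  tendsto : Tendsto (fun x : ℝ => Complex.exp (-(Complex.I * k * x)) • u x) atTop (𝓝 1)
  tendsto_deriv : Tendsto (fun x : ℝ => Complex.exp (-(Complex.I * k * x)) • halfDeriv u x)
    atTop (𝓝 ((Complex.I * k) • (1 : Matrix (Fin n) (Fin n) ℂ)))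

/-- `u` is the regular solution at `k`: it solves the equation and `u(0) = A`, `u'(0) = B`. -/
structure IsRegularSolution {n : ℕ} (V : ℝ → Matrix (Fin n) (Fin n) ℂ)
    (A B : Matrix (Fin n) (Fin n) ℂ) (k : ℂ)
    (u : ℝ → Matrix (Fin n) (Fin n) ℂ) : Prop where
  isSolution : IsSolution V k u
  apply_zero : u 0 = A
  deriv_zero : halfDeriv u 0 = B

/-- The Jost solution `f(k, ·)`. For `V` integrable, `Im k ≥ 0` and `k ≠ 0` it exists and is
unique on `[0, ∞)`; otherwise this value is not used. -/
def jostSolution {n : ℕ} (V : ℝ → Matrix (Fin n) (Fin n) ℂ) (k : ℂ) :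
    ℝ → Matrix (Fin n) (Fin n) ℂ :=
  Classical.epsilon (IsJostSolution V k)

/-- The regular solution `φ_{A,B}(k, ·)`. For `V` integrable it exists and is unique on
`[0, ∞)`. -/
def regularSolution {n : ℕ} (V : ℝ → Matrix (Fin n) (Fin n) ℂ)
    (A B : Matrix (Fin n) (Fin n) ℂ) (k : ℂ) : ℝ → Matrix (Fin n) (Fin n) ℂ :=
  Classical.epsilon (IsRegularSolution V A B k)

/-- The Wronskian `[F; G] = F G' - F' G`. -/
def wronskian {n : ℕ} (F G : ℝ → Matrix (Fin n) (Fin n) ℂ) (x : ℝ) :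
    Matrix (Fin n) (Fin n) ℂ :=
  F x * halfDeriv G x - halfDeriv F x * G x

/-- The Jost matrix `J_{A,B}(k) = [f(-k*, x)†; φ_{A,B}(k, x)]`, a Wronskian that does not depend
on `x`; it is evaluated at `x = 0`. -/
def jostMatrix {n : ℕ} (V : ℝ → Matrix (Fin n) (Fin n) ℂ)
    (A B : Matrix (Fin n) (Fin n) ℂ) (k : ℂ) : Matrix (Fin n) (Fin n) ℂ :=
  wronskian (fun x => (jostSolution V (-(starRingEnd ℂ k)) x)ᴴ) (regularSolution V A B k) 0

/-- The physical solution `ψ_{A,B}(k, x) = -i k φ_{A,B}(k, x) J_{A,B}(k)⁻¹`. -/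
def physicalSolution {n : ℕ} (V : ℝ → Matrix (Fin n) (Fin n) ℂ)
    (A B : Matrix (Fin n) (Fin n) ℂ) (k : ℂ) (x : ℝ) : Matrix (Fin n) (Fin n) ℂ :=
  (-(Complex.I * k)) • (regularSolution V A B k x * (jostMatrix V A B k)⁻¹)

/-- The scattering matrix `S_{A,B}(k) = -J_{A,B}(-k) J_{A,B}(k)⁻¹`, for real `k ≠ 0`. -/
def scatteringMatrix {n : ℕ} (V : ℝ → Matrix (Fin n) (Fin n) ℂ)
    (A B : Matrix (Fin n) (Fin n) ℂ) (k : ℝ) : Matrix (Fin n) (Fin n) ℂ :=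
  -(jostMatrix V A B (-(k : ℂ)) * (jostMatrix V A B k)⁻¹)

end

end MatrixSchrodinger

/-! Write `[F; G] = F G' - F' G`, and let `ψ₀`, `ψ` be the free and the perturbed physical solution.
With zero potential, left and right multiplication by the potential agree, so `ψ₀` may stand in the
left slot without an adjoint; the `k²` terms cancel and `[ψ₀; ψ]' = ψ₀ V ψ`. The theorem is this
identity integrated over the half line.

At `0` the Wronskian vanishes, because `J₀ = B - ikA` gives `A J₀⁻¹ B = B J₀⁻¹ A`
(`wronskian_physicalSolution_zero`). At infinity, `ψ = ½ (f(k) S + f(-k))`, and likewise for `ψ₀`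
with scalar exponentials in place of `f(±k)`, so only Wronskians of Jost asymptotics survive and the
limit is `(ik/2) (S - S₀)` (`tendsto_wronskian_physicalSolution`).

Invertibility of `J(k)`: inserting the Jost expansion of `A` and `B` into `A†B - B†A = 0` gives
`J(-k)†J(-k) = J(k)†J(k)`. A kernel vector of `J(k)` is then killed by `J(-k)`, hence by `A` and
`B`, against positivity.

Since `f` and `φ` are chosen by `Classical.epsilon`, existence must be proved. `exists_jost` solves
the Volterra equation of `f` by its Neumann series; `φ` is a combination of `f(k)` and `f(-k)` with
coefficients from `eq_of_wronskians`. As `V` is merely integrable, derivatives are handled in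
integrated form (`IsPrimitive`), with a product rule for absolutely continuous functions. -/

namespace MatrixSchrodinger

/-! ### Indefinite integrals and the product rule. -/

section Primitive

open AbsolutelyContinuousOnInterval in
/-- A function whose increments are controlled by those of two absolutely continuous functions is
absolutely continuous. -/
theorem absolutelyContinuousOnInterval_of_dist_le {X Y Z : Type*} [PseudoMetricSpace X]
    [PseudoMetricSpace Y] [PseudoMetricSpace Z] {f : ℝ → X} {g : ℝ → Y} {h : ℝ → Z} {a b C D : ℝ}
    (hg : AbsolutelyContinuousOnInterval g a b) (hh : AbsolutelyContinuousOnInterval h a b)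
    (hle : ∀ x ∈ uIcc a b, ∀ y ∈ uIcc a b,
      dist (f x) (f y) ≤ C * dist (g x) (g y) + D * dist (h x) (h y)) :
    AbsolutelyContinuousOnInterval f a b := by
  have key := (Tendsto.const_mul C hg).add (Tendsto.const_mul D hh)
  simp only [mul_zero, add_zero] at key
  refine squeeze_zero' (Eventually.of_forall fun E => Finset.sum_nonneg fun i _ => dist_nonneg) ?_
    key
  refine eventually_inf_principal.2 (Eventually.of_forall fun E hE => ?_)
  rw [Finset.mul_sum, Finset.mul_sum, ← Finset.sum_add_distrib]
  refine Finset.sum_le_sum fun i hi => ?_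
  obtain ⟨h1, h2⟩ := hE.1 i hi
  exact hle _ h1 _ h2

/-- Increments of the integral of `f` are bounded by those of the real primitive of `‖f‖`. -/
theorem absolutelyContinuousOnInterval_primitive {E : Type*} [NormedAddCommGroup E]
    [NormedSpace ℝ E] {f : ℝ → E} {a b : ℝ} (hf : IntervalIntegrable f volume a b) :
    AbsolutelyContinuousOnInterval (fun x => ∫ t in a..x, f t) a b := by
  have hN := hf.norm.absolutelyContinuousOnInterval_intervalIntegral (c := a) left_mem_uIcc
  refine absolutelyContinuousOnInterval_of_dist_le (C := 1) (D := 0) hN hN fun x hx y hy => ?_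
  have hsub : ∀ z ∈ uIcc a b, IntervalIntegrable f volume a z := fun z hz =>
    hf.mono_set (uIcc_subset_uIcc_left hz)
  have hx' := hsub x hx
  have hy' := hsub y hy
  rw [dist_eq_norm, Real.dist_eq, intervalIntegral.integral_interval_sub_left hx' hy',
    intervalIntegral.integral_interval_sub_left hx'.norm hy'.norm, one_mul, zero_mul, add_zero]
  exact intervalIntegral.norm_integral_le_abs_integral_norm

/-- `F` is an indefinite integral of the locally integrable function `a` on `[0, ∞)`. -/
structure IsPrimitive {E : Type*} [NormedAddCommGroup E] [NormedSpace ℝ E] (F a : ℝ → E) :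
    Prop where
  intervalIntegrable : ∀ x, 0 ≤ x → IntervalIntegrable a volume 0 x
  eq : ∀ x, 0 ≤ x → F x = F 0 + ∫ t in (0 : ℝ)..x, a t

namespace IsPrimitive

variable {E : Type*} [NormedAddCommGroup E] [NormedSpace ℝ E] {F G a b : ℝ → E}

/-- The densities need not agree at `0`, which the half-open integrals omit; this fits hypotheses on
`V x` for `0 < x` only. -/
theorem congr (h : IsPrimitive F a) (hF : EqOn F G (Ici 0)) (ha : EqOn a b (Ioi 0)) :
    IsPrimitive G b := by
  have hab : ∀ x, 0 ≤ x → EqOn a b (uIoc 0 x) := fun x hx t ht =>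
    ha (by rw [uIoc_of_le hx] at ht; exact ht.1)
  refine ⟨fun x hx => (h.intervalIntegrable x hx).congr (hab x hx), fun x hx => ?_⟩
  rw [← hF hx, ← hF (mem_Ici.2 le_rfl), h.eq x hx]
  congr 1
  exact intervalIntegral.integral_congr_ae (Eventually.of_forall fun t ht => hab x hx ht)

theorem continuousOn (h : IsPrimitive F a) : ContinuousOn F (Ici 0) := by
  intro x hx
  have hx' : (0 : ℝ) ≤ x := hx
  have h1 : ContinuousOn (fun y => F 0 + ∫ t in (0 : ℝ)..y, a t) (uIcc 0 (x + 1)) :=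
    continuousOn_const.add (intervalIntegral.continuousOn_primitive_interval'
      (h.intervalIntegrable (x + 1) (by linarith)) left_mem_uIcc)
  have h2 : ContinuousOn F (Icc 0 (x + 1)) := by
    rw [uIcc_of_le (by linarith)] at h1
    exact h1.congr fun y hy => h.eq y hy.1
  refine (h2 x ⟨hx', by linarith⟩).mono_of_mem_nhdsWithin ?_
  rw [mem_nhdsWithin]
  exact ⟨Iio (x + 1), isOpen_Iio, by simp, fun y hy => ⟨hy.2, le_of_lt hy.1⟩⟩

theorem const (c : E) : IsPrimitive (fun _ => c) 0 := 
  ⟨fun x _ => intervalIntegrable_const (c := (0 : E)), fun x _ => by simp⟩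

theorem add (hF : IsPrimitive F a) (hG : IsPrimitive G b) : IsPrimitive (F + G) (a + b) := by
  refine ⟨fun x hx => (hF.intervalIntegrable x hx).add (hG.intervalIntegrable x hx),
    fun x hx => ?_⟩
  simp only [Pi.add_apply]
  rw [intervalIntegral.integral_add (hF.intervalIntegrable x hx) (hG.intervalIntegrable x hx),
    hF.eq x hx, hG.eq x hx]
  abel

theorem map {E' : Type*} [NormedAddCommGroup E'] [NormedSpace ℝ E'] [CompleteSpace E]
    [CompleteSpace E'] (h : IsPrimitive F a) (L : E →L[ℝ] E') :
    IsPrimitive (fun x => L (F x)) (fun x => L (a x)) := by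
  refine ⟨fun x hx => ?_, fun x hx => ?_⟩
  · have := h.intervalIntegrable x hx
    rw [intervalIntegrable_iff] at this ⊢
    exact L.integrable_comp this
  · rw [L.intervalIntegral_comp_comm (h.intervalIntegrable x hx), h.eq x hx, map_add]

theorem neg (h : IsPrimitive F a) : IsPrimitive (-F) (-a) := by
  refine ⟨fun x hx => (h.intervalIntegrable x hx).neg, fun x hx => ?_⟩
  simp only [Pi.neg_apply]
  rw [intervalIntegral.integral_neg, h.eq x hx]
  abel

theorem sub (hF : IsPrimitive F a) (hG : IsPrimitive G b) : IsPrimitive (F - G) (a - b) := by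
  rw [sub_eq_add_neg, sub_eq_add_neg]
  exact hF.add hG.neg

/-- A primitive of a function vanishing on the half line is constant there. -/
theorem eq_apply_zero (h : IsPrimitive F a) (ha : ∀ x, 0 < x → a x = 0) {x : ℝ} (hx : 0 ≤ x) :
    F x = F 0 := by
  have := (h.congr (eqOn_refl F _) (b := 0) fun t ht => ha t ht).eq x hx
  simpa using this

theorem of_hasDerivWithinAt [CompleteSpace E] (ha : ContinuousOn a (Ici 0))
    (h : ∀ x, 0 ≤ x → HasDerivWithinAt F (a x) (Ici 0) x) : IsPrimitive F a := by
  have hint : ∀ x, 0 ≤ x → IntervalIntegrable a volume 0 x := fun x hx =>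
    (ha.mono (by rw [uIcc_of_le hx]; exact Icc_subset_Ici_self)).intervalIntegrable
  refine ⟨hint, fun x hx => ?_⟩
  rw [intervalIntegral.integral_eq_sub_of_hasDeriv_right (f := F) _ _ (hint x hx)]
  · abel
  · rw [uIcc_of_le hx]
    exact fun y hy => (h y hy.1).continuousWithinAt.mono Icc_subset_Ici_self
  · intro y hy
    rw [min_eq_left hx] at hy
    exact (h y hy.1.le).mono (Ioi_subset_Ici hy.1.le)

theorem hasDerivWithinAt [CompleteSpace E] (h : IsPrimitive F a) (ha : ContinuousOn a (Ici 0))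
    {x : ℝ} (hx : 0 ≤ x) : HasDerivWithinAt F (a x) (Ici 0) x := by
  -- extend `a` continuously to the whole line
  set a' : ℝ → E := fun t => a (max t 0) with ha'
  have hcont : Continuous a' :=
    ha.comp_continuous (by fun_prop) fun t => le_max_right t 0
  have haa : EqOn a a' (Ioi 0) := fun t ht => by simp [ha', max_eq_left (le_of_lt (mem_Ioi.1 ht))]
  have h' := h.congr (eqOn_refl F _) haa
  have hd : HasDerivAt (fun y => F 0 + ∫ t in (0 : ℝ)..y, a' t) (a' x) x :=
    (intervalIntegral.integral_hasDerivAt_right (hcont.intervalIntegrable _ _)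
      (hcont.stronglyMeasurableAtFilter _ _) hcont.continuousAt).const_add _
  have hax : a' x = a x := by simp [ha', max_eq_left hx]
  rw [← hax]
  exact hd.hasDerivWithinAt.congr (fun y hy => h'.eq y hy) (h'.eq x hx)

theorem tendsto (h : IsPrimitive F a) (ha : IntegrableOn a (Ioi 0)) :
    Tendsto F atTop (𝓝 (F 0 + ∫ t in Ioi 0, a t)) := by
  refine ((intervalIntegral_tendsto_integral_Ioi 0 ha tendsto_id).const_add (F 0)).congr' ?_
  filter_upwards [eventually_ge_atTop 0] with x hx
  exact (h.eq x hx).symm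

theorem absolutelyContinuousOnInterval (h : IsPrimitive F a) {x : ℝ} (hx : 0 ≤ x) :
    AbsolutelyContinuousOnInterval F 0 x := by
  have hp := absolutelyContinuousOnInterval_primitive (h.intervalIntegrable x hx)
  refine absolutelyContinuousOnInterval_of_dist_le (C := 1) (D := 0) hp hp fun y hy z hz => ?_
  rw [uIcc_of_le hx] at hy hz
  rw [h.eq y hy.1, h.eq z hz.1]
  simp

theorem ae_hasDerivAt (h : IsPrimitive F a) {x : ℝ} (hx : 0 ≤ x) [CompleteSpace E] :
    ∀ᵐ y, y ∈ uIcc 0 x → HasDerivAt F (a y) y := by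
  -- Nothing is known about `F` to the left of `0`, so a two-sided derivative is available only at
  -- `y ≠ 0`.
  have h0 : ∀ᵐ y : ℝ, y ≠ 0 := by simp [ae_iff, measure_singleton]
  filter_upwards [(h.intervalIntegrable x hx).ae_hasDerivAt_integral, h0] with y hy hy0 hyx
  refine ((hy hyx 0 left_mem_uIcc).const_add (F 0)).congr_of_eventuallyEq ?_
  rw [uIcc_of_le hx] at hyx
  filter_upwards [Ioi_mem_nhds (lt_of_le_of_ne hyx.1 (Ne.symm hy0))] with z hz
  exact h.eq z (le_of_lt hz)

variable {R : Type*} [NormedRing R] [NormedAlgebra ℝ R] [CompleteSpace R] {P Q p q : ℝ → R}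

/-- The product rule for absolutely continuous functions. -/
theorem mul (hP : IsPrimitive P p) (hQ : IsPrimitive Q q) :
    IsPrimitive (fun x => P x * Q x) (fun x => p x * Q x + P x * q x) := by
  have hsub : ∀ x : ℝ, 0 ≤ x → uIcc 0 x ⊆ Ici 0 := fun x hx => by
    rw [uIcc_of_le hx]; exact Icc_subset_Ici_self
  have hint : ∀ x, 0 ≤ x →
      IntervalIntegrable (fun x => p x * Q x + P x * q x) volume 0 x := fun x hx =>
    ((hP.intervalIntegrable x hx).mul_continuousOn (hQ.continuousOn.mono (hsub x hx))).add
      ((hQ.intervalIntegrable x hx).continuousOn_mul (hP.continuousOn.mono (hsub x hx)))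
  refine ⟨hint, fun x hx => ?_⟩
  obtain ⟨C, hC⟩ := (isCompact_uIcc (a := (0 : ℝ)) (b := x)).exists_bound_of_continuousOn
    (hP.continuousOn.mono (hsub x hx))
  obtain ⟨D, hD⟩ := (isCompact_uIcc (a := (0 : ℝ)) (b := x)).exists_bound_of_continuousOn
    (hQ.continuousOn.mono (hsub x hx))
  have hPQ : AbsolutelyContinuousOnInterval (fun x => P x * Q x) 0 x := by
    refine absolutelyContinuousOnInterval_of_dist_le (C := D) (D := C)
      (hP.absolutelyContinuousOnInterval hx) (hQ.absolutelyContinuousOnInterval hx)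
      fun y hy z hz => ?_
    rw [dist_eq_norm, dist_eq_norm, dist_eq_norm,
      show P y * Q y - P z * Q z = (P y - P z) * Q y + P z * (Q y - Q z) by noncomm_ring,
      mul_comm D]
    refine (norm_add_le _ _).trans (add_le_add ((norm_mul_le _ _).trans ?_)
      ((norm_mul_le _ _).trans ?_))
    · exact mul_le_mul_of_nonneg_left (hD y hy) (norm_nonneg _)
    · exact mul_le_mul_of_nonneg_right (hC z hz) (norm_nonneg _)
  -- `P Q` minus the integral of the claimed density is absolutely continuous with derivative zero
  -- almost everywhere, hence constant.
  obtain ⟨c, hc⟩ := (hPQ.fun_sub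
    (absolutelyContinuousOnInterval_primitive (hint x hx))).const_of_ae_hasDerivAt_zero (by
      filter_upwards [hP.ae_hasDerivAt hx, hQ.ae_hasDerivAt hx,
        (hint x hx).ae_hasDerivAt_integral] with y h1 h2 h3 hy
      have := ((h1 hy).mul (h2 hy)).sub (h3 hy 0 left_mem_uIcc)
      rwa [sub_self] at this)
  have e0 := hc 0 left_mem_uIcc
  have e1 := hc x right_mem_uIcc
  rw [intervalIntegral.integral_same, sub_zero] at e0
  rw [sub_eq_iff_eq_add] at e1
  rw [e1, e0]

end IsPrimitive

end Primitive

end MatrixSchrodinger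
namespace MatrixSchrodinger

/-! ### Tail integrals and their powers. -/

section Tail

theorem isPrimitive_tail {E : Type*} [NormedAddCommGroup E] [NormedSpace ℝ E] {g : ℝ → E}
    (hg : IntegrableOn g (Ioi 0)) : IsPrimitive (fun x => ∫ t in Ioi x, g t) (-g) := by
  have hint : ∀ x, 0 ≤ x → IntervalIntegrable g volume 0 x := fun x hx =>
    (intervalIntegrable_iff_integrableOn_Ioc_of_le hx).2 (hg.mono_set Ioc_subset_Ioi_self)
  refine ⟨fun x hx => (hint x hx).neg, fun x hx => ?_⟩
  simp only [Pi.neg_apply]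
  rw [intervalIntegral.integral_neg, ← intervalIntegral.integral_interval_add_Ioi (a := 0) (b := x)
    hg (hg.mono_set (Ioi_subset_Ioi hx))]
  abel

theorem tendsto_tail {E : Type*} [NormedAddCommGroup E] [NormedSpace ℝ E] {g : ℝ → E}
    (hg : IntegrableOn g (Ioi 0)) : Tendsto (fun x => ∫ t in Ioi x, g t) atTop (𝓝 0) := by
  have := (isPrimitive_tail hg).tendsto hg.neg
  simp only [Pi.neg_apply] at this
  rwa [integral_neg, add_neg_cancel] at this

variable {w : ℝ → ℝ}

/-- The power rule in integrated form, by induction from the product rule, since `w` is only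
integrable. -/
theorem isPrimitive_tail_pow (hw : IntegrableOn w (Ioi 0)) (n : ℕ) :
    IsPrimitive (fun x => (∫ t in Ioi x, w t) ^ (n + 1))
      (fun x => -((n + 1) * (w x * (∫ t in Ioi x, w t) ^ n))) := by
  induction n with
  | zero =>
    exact (isPrimitive_tail hw).congr (fun x _ => by simp) fun x _ => by simp
  | succ n ih =>
    refine (ih.mul (isPrimitive_tail hw)).congr (fun x _ => ?_) fun x _ => ?_
    · simp only [pow_succ]
    · simp only [Pi.neg_apply]
      push_cast
      ring

theorem tail_nonneg (h0 : ∀ t, 0 ≤ w t) (x : ℝ) : 0 ≤ ∫ t in Ioi x, w t :=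
  integral_nonneg h0

theorem tail_anti (hw : IntegrableOn w (Ioi 0)) (h0 : ∀ t, 0 ≤ w t) {x y : ℝ} (hx : 0 ≤ x)
    (hxy : x ≤ y) : ∫ t in Ioi y, w t ≤ ∫ t in Ioi x, w t :=
  setIntegral_mono_set (hw.mono_set (Ioi_subset_Ioi hx)) (Eventually.of_forall h0)
    (LE.le.eventuallyLE (Ioi_subset_Ioi hxy))

theorem integrableOn_mul_tail_pow (hw : IntegrableOn w (Ioi 0)) (h0 : ∀ t, 0 ≤ w t) (n : ℕ) :
    IntegrableOn (fun t => w t * (∫ s in Ioi t, w s) ^ n) (Ioi 0) := by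
  refine Integrable.mul_bdd (c := (∫ s in Ioi (0 : ℝ), w s) ^ n) hw ?_ ?_
  · exact (((isPrimitive_tail hw).continuousOn.mono Ioi_subset_Ici_self).pow n).aestronglyMeasurable
      measurableSet_Ioi
  · refine (ae_restrict_mem measurableSet_Ioi).mono fun t ht => ?_
    rw [Real.norm_of_nonneg (pow_nonneg (tail_nonneg h0 t) n)]
    exact pow_le_pow_left₀ (tail_nonneg h0 t) (tail_anti hw h0 le_rfl (le_of_lt ht)) n

/-- With `T` the tail of `w`, the integrand is the derivative of `-T ^ (n + 1) / (n + 1)`, and `T`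
tends to `0`. This produces the factorials that make the Neumann series converge. -/
theorem integral_mul_tail_pow (hw : IntegrableOn w (Ioi 0)) (h0 : ∀ t, 0 ≤ w t) (n : ℕ) {x : ℝ}
    (hx : 0 ≤ x) :
    ∫ t in Ioi x, w t * (∫ s in Ioi t, w s) ^ n = (∫ s in Ioi x, w s) ^ (n + 1) / (n + 1) := by
  have hp := isPrimitive_tail_pow hw n
  have hi := integrableOn_mul_tail_pow hw h0 n
  have hn : (n : ℝ) + 1 ≠ 0 := by positivity
  have e1 := hp.eq x hx
  have e2 := (hp.tendsto (hi.const_mul ((n : ℝ) + 1)).neg)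
  have e3 : Tendsto (fun x => (∫ t in Ioi x, w t) ^ (n + 1)) atTop (𝓝 0) := by
    simpa using (tendsto_tail hw).pow (n + 1)
  have e4 := tendsto_nhds_unique e2 e3
  have e5 := intervalIntegral.integral_interval_add_Ioi hi (hi.mono_set (Ioi_subset_Ioi hx))
  rw [intervalIntegral.integral_neg, intervalIntegral.integral_const_mul] at e1
  rw [integral_neg, integral_const_mul] at e4
  rw [eq_div_iff hn]
  rw [← e5] at e4
  linarith

end Tail

/-! ### Existence of the Jost solution by a Neumann series. -/

section Jost

variable {R : Type*} [NormedRing R] [NormedAlgebra ℂ R] {V : ℝ → R} {k : ℝ}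

/-- The Volterra operator of the Jost integral equation, `u ↦ ∫_x^∞ k⁻¹ sin k(t - x) V(t) u(t) dt`
with the kernel split into exponentials. -/
noncomputable def volterra (V : ℝ → R) (k : ℝ) (u : ℝ → R) (x : ℝ) : R :=
  (2 * (Complex.I * k))⁻¹ •
    (Complex.exp (-(Complex.I * k * x)) • (∫ t in Ioi x, Complex.exp (Complex.I * k * t) •
        (V t * u t)) -
      Complex.exp (Complex.I * k * x) • (∫ t in Ioi x, Complex.exp (-(Complex.I * k * t)) •
        (V t * u t)))

theorem norm_exp_I_mul (k x : ℝ) : ‖Complex.exp (Complex.I * k * x)‖ = 1 := by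
  rw [mul_assoc, mul_comm, ← Complex.ofReal_mul, Complex.norm_exp_ofReal_mul_I]

theorem norm_exp_neg_I_mul (k x : ℝ) : ‖Complex.exp (-(Complex.I * k * x))‖ = 1 := by
  rw [Complex.exp_neg, norm_inv, norm_exp_I_mul, inv_one]

theorem integrableOn_smul_mul (hV : IntegrableOn V (Ioi 0)) {e : ℝ → ℂ} (he : Continuous e)
    (he1 : ∀ x, ‖e x‖ = 1) {u : ℝ → R} (hu : ContinuousOn u (Ici 0)) {C : ℝ}
    (hC : ∀ x, 0 ≤ x → ‖u x‖ ≤ C) : IntegrableOn (fun t => e t • (V t * u t)) (Ioi 0) := by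
  have hVu : IntegrableOn (fun t => V t * u t) (Ioi 0) :=
    Integrable.mul_bdd (c := C) hV
      ((hu.mono Ioi_subset_Ici_self).aestronglyMeasurable measurableSet_Ioi)
      ((ae_restrict_mem measurableSet_Ioi).mono fun t ht => hC t (le_of_lt ht))
  exact Integrable.bdd_smul hVu 1 he.aestronglyMeasurable (Eventually.of_forall fun t => (he1 t).le)

theorem continuous_exp_I_mul (k : ℝ) : Continuous fun x : ℝ => Complex.exp (Complex.I * k * x) := by
  fun_prop

theorem continuous_exp_neg_I_mul (k : ℝ) :
    Continuous fun x : ℝ => Complex.exp (-(Complex.I * k * x)) := by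
  fun_prop

theorem continuousOn_volterra (hV : IntegrableOn V (Ioi 0)) {u : ℝ → R}
    (hu : ContinuousOn u (Ici 0)) {C : ℝ} (hC : ∀ x, 0 ≤ x → ‖u x‖ ≤ C) :
    ContinuousOn (volterra V k u) (Ici 0) := by
  have h1 := (isPrimitive_tail (integrableOn_smul_mul hV (continuous_exp_I_mul k)
    (norm_exp_I_mul k) hu hC)).continuousOn
  have h2 := (isPrimitive_tail (integrableOn_smul_mul hV (continuous_exp_neg_I_mul k)
    (norm_exp_neg_I_mul k) hu hC)).continuousOn
  exact (((continuous_exp_neg_I_mul k).continuousOn.smul h1).sub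
    ((continuous_exp_I_mul k).continuousOn.smul h2)).const_smul _

/-- Each of the two unimodular exponentials contributes half of `|k|⁻¹`. At `k = 0` both sides are
zero, as `0⁻¹ = 0`. -/
theorem norm_volterra_le {u : ℝ → R} {b : ℝ → ℝ} {x : ℝ}
    (hb : IntegrableOn (fun t => ‖V t‖ * b t) (Ioi x)) (hub : ∀ t, x < t → ‖u t‖ ≤ b t) :
    ‖volterra V k u x‖ ≤ |k|⁻¹ * ∫ t in Ioi x, ‖V t‖ * b t := by
  have key : ∀ e : ℝ → ℂ, (∀ t, ‖e t‖ = 1) →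
      ‖∫ t in Ioi x, e t • (V t * u t)‖ ≤ ∫ t in Ioi x, ‖V t‖ * b t := by
    intro e he
    refine norm_integral_le_of_norm_le hb
      ((ae_restrict_mem measurableSet_Ioi).mono fun t ht => ?_)
    rw [norm_smul, he, one_mul]
    exact (norm_mul_le _ _).trans (mul_le_mul_of_nonneg_left (hub t ht) (norm_nonneg _))
  have h1 := key _ (norm_exp_I_mul k)
  have h2 := key _ (norm_exp_neg_I_mul k)
  rw [volterra, norm_smul]
  have h3 : ‖(2 * (Complex.I * k))⁻¹‖ = 2⁻¹ * |k|⁻¹ := by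
    simp [mul_comm]
  have h4 : 0 ≤ |k|⁻¹ := by positivity
  rw [h3]
  refine (mul_le_mul_of_nonneg_left (norm_sub_le _ _) (by positivity)).trans ?_
  rw [norm_smul, norm_smul, norm_exp_I_mul, norm_exp_neg_I_mul, one_mul, one_mul]
  nlinarith

/-- The terms of the Neumann series of the Jost integral equation. -/
noncomputable def jostTerm (V : ℝ → R) (k : ℝ) : ℕ → ℝ → R
  | 0 => fun x => Complex.exp (Complex.I * k * x) • 1
  | m + 1 => volterra V k (jostTerm V k m)

/-- Each application of the Volterra operator integrates `‖V‖` times a power of its tail, raising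
the exponent and dividing by it. The factor `‖1‖` stays because `R` need not have `‖1‖ = 1` (it may
be the zero ring, as for `n = 0`). -/
theorem jostTerm_bound (hV : IntegrableOn V (Ioi 0)) (m : ℕ) :
    ContinuousOn (jostTerm V k m) (Ici 0) ∧ ∀ x, 0 ≤ x →
      ‖jostTerm V k m x‖ ≤ ‖(1 : R)‖ * ((|k|⁻¹ * ∫ t in Ioi x, ‖V t‖) ^ m / m.factorial) := by
  have h0 : ∀ t, 0 ≤ ‖V t‖ := fun t => norm_nonneg _
  induction m with
  | zero =>
    refine ⟨((continuous_exp_I_mul k).smul continuous_const).continuousOn, fun x _ => ?_⟩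
    simp [jostTerm, norm_smul, norm_exp_I_mul]
  | succ m ih =>
    obtain ⟨hc, hb⟩ := ih
    refine ⟨continuousOn_volterra hV hc (C := ‖(1 : R)‖ *
      ((|k|⁻¹ * ∫ t in Ioi (0 : ℝ), ‖V t‖) ^ m / m.factorial)) fun x hx =>
        (hb x hx).trans ?_, fun x hx => ?_⟩
    · have h1 := tail_anti hV.norm h0 le_rfl hx
      have h2 := tail_nonneg h0 x
      gcongr
    · have hi : ∀ t, ‖V t‖ * (‖(1 : R)‖ * ((|k|⁻¹ * ∫ s in Ioi t, ‖V s‖) ^ m / m.factorial)) =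
          (‖(1 : R)‖ * |k|⁻¹ ^ m / m.factorial) * (‖V t‖ * (∫ s in Ioi t, ‖V s‖) ^ m) := by
        intro t; rw [mul_pow]; ring
      have hint := (integrableOn_mul_tail_pow hV.norm h0 m).const_mul
        (‖(1 : R)‖ * |k|⁻¹ ^ m / m.factorial)
      simp_rw [← hi] at hint
      refine (norm_volterra_le (IntegrableOn.mono_set hint (Ioi_subset_Ioi hx)) fun t ht =>
        hb t (hx.trans ht.le)).trans (le_of_eq ?_)
      simp_rw [hi]
      rw [integral_const_mul, integral_mul_tail_pow hV.norm h0 m hx, Nat.factorial_succ]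
      push_cast
      rw [mul_pow, pow_succ |k|⁻¹]
      field_simp

variable [CompleteSpace R]

/-- The Jost integral equation is solvable by a bounded continuous function. -/
theorem exists_jost_volterra (hV : IntegrableOn V (Ioi 0)) (k : ℝ) :
    ∃ u : ℝ → R, ContinuousOn u (Ici 0) ∧ (∃ C, ∀ x, 0 ≤ x → ‖u x‖ ≤ C) ∧
      ∀ x, 0 ≤ x → u x = Complex.exp (Complex.I * k * x) • 1 + volterra V k u x := by
  have h0 : ∀ t, 0 ≤ ‖V t‖ := fun t => norm_nonneg _
  set D : ℝ := |k|⁻¹ * ∫ t in Ioi (0 : ℝ), ‖V t‖ with hD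
  set c : ℕ → ℝ := fun m => ‖(1 : R)‖ * (D ^ m / m.factorial) with hc
  have hsum : Summable c := (Real.summable_pow_div_factorial D).mul_left _
  have hle : ∀ m x, 0 ≤ x → ‖jostTerm V k m x‖ ≤ c m := fun m x hx => by
    refine ((jostTerm_bound hV m).2 x hx).trans ?_
    have h1 := tail_anti hV.norm h0 le_rfl hx
    have h2 := tail_nonneg h0 x
    simp only [hc, hD]
    gcongr
  have hcont : ContinuousOn (fun x => ∑' m, jostTerm V k m x) (Ici 0) :=
    continuousOn_tsum (fun m => (jostTerm_bound hV m).1) hsum fun m x hx => hle m x hx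
  have hbd : ∀ x, 0 ≤ x → ‖∑' m, jostTerm V k m x‖ ≤ ∑' m, c m := fun x hx =>
    tsum_of_norm_bounded hsum.hasSum fun m => hle m x hx
  have hs : ∀ x, 0 ≤ x → Summable fun m => jostTerm V k m x := fun x hx =>
    hsum.of_norm_bounded fun m => hle m x hx
  refine ⟨fun x => ∑' m, jostTerm V k m x, hcont, ⟨_, hbd⟩, fun x hx => ?_⟩
  -- Summation commutes with each of the two integrals in the Volterra operator, with dominating
  -- function `‖V t‖` times the sum of `c`.
  have key : ∀ e : ℝ → ℂ, Continuous e → (∀ t, ‖e t‖ = 1) →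
      HasSum (fun m => ∫ t in Ioi x, e t • (V t * jostTerm V k m t))
        (∫ t in Ioi x, e t • (V t * ∑' m, jostTerm V k m t)) := by
    intro e he he1
    refine hasSum_integral_of_dominated_convergence (fun m t => ‖V t‖ * c m) (fun m => ?_)
      (fun m => ?_) ?_ ?_ ?_
    · exact ((integrableOn_smul_mul hV he he1 (jostTerm_bound hV m).1 (hle m)).mono_set
        (Ioi_subset_Ioi hx)).aestronglyMeasurable
    · refine (ae_restrict_mem measurableSet_Ioi).mono fun t ht => ?_
      rw [norm_smul, he1, one_mul]
      exact (norm_mul_le _ _).trans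
        (mul_le_mul_of_nonneg_left (hle m t (hx.trans (le_of_lt ht))) (norm_nonneg _))
    · exact Eventually.of_forall fun t => hsum.mul_left _
    · simp_rw [tsum_mul_left]
      exact (IntegrableOn.mono_set hV.norm (Ioi_subset_Ioi hx)).mul_const _
    · refine (ae_restrict_mem measurableSet_Ioi).mono fun t ht => ?_
      exact ((hs t (hx.trans (le_of_lt ht))).hasSum.mul_left _).const_smul _
  have h3 : HasSum (fun m => jostTerm V k (m + 1) x)
      (volterra V k (fun x => ∑' m, jostTerm V k m x) x) :=
    (((key _ (continuous_exp_I_mul k) (norm_exp_I_mul k)).const_smul _).sub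
      ((key _ (continuous_exp_neg_I_mul k) (norm_exp_neg_I_mul k)).const_smul _)).const_smul _
  change ∑' m, jostTerm V k m x = _
  rw [(hs x hx).tsum_eq_zero_add, h3.tsum_eq]
  rfl

/-- For real `k ≠ 0` there is a Jost solution, together with its derivative. -/
theorem exists_jost (hV : IntegrableOn V (Ioi 0)) (hk : k ≠ 0) :
    ∃ u v : ℝ → R, IsPrimitive u v ∧ IsPrimitive v (fun t => V t * u t - (k : ℂ) ^ 2 • u t) ∧
      Tendsto (fun x : ℝ => Complex.exp (-(Complex.I * k * x)) • u x) atTop (𝓝 1) ∧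
      Tendsto (fun x : ℝ => Complex.exp (-(Complex.I * k * x)) • v x) atTop
        (𝓝 ((Complex.I * k) • (1 : R))) := by
  obtain ⟨u, hu, ⟨C, hC⟩, he⟩ := exists_jost_volterra hV k
  set c : ℂ := Complex.I * k with hc
  have hc0 : c ≠ 0 := by simp [hc, hk]
  have hc2 : (k : ℂ) ^ 2 = -c ^ 2 := by rw [hc, mul_pow, Complex.I_sq]; ring
  set ep : ℝ → ℂ := fun x => Complex.exp (c * x) with hep
  set em : ℝ → ℂ := fun x => Complex.exp (-(c * x)) with hem
  have hpm : ∀ x, em x * ep x = 1 := fun x => by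
    simp only [hep, hem]; rw [← Complex.exp_add]; simp
  have ip := integrableOn_smul_mul hV (continuous_exp_I_mul k) (norm_exp_I_mul k) hu hC
  have im := integrableOn_smul_mul hV (continuous_exp_neg_I_mul k) (norm_exp_neg_I_mul k) hu hC
  -- Variation of parameters: `u = ep a + em b`, with `a → 1` and `b → 0` at infinity.
  set a : ℝ → R := fun x => 1 - (2 * c)⁻¹ • ∫ t in Ioi x, em t • (V t * u t) with ha
  set b : ℝ → R := fun x => (2 * c)⁻¹ • ∫ t in Ioi x, ep t • (V t * u t) with hb
  have pa : IsPrimitive a (fun t => (2 * c)⁻¹ • em t • (V t * u t)) := by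
    refine ((IsPrimitive.const (1 : R)).sub ((isPrimitive_tail im).map
      (((2 * c)⁻¹ • ContinuousLinearMap.id ℂ R).restrictScalars ℝ))).congr
        (fun x _ => by simp [ha]; rfl) fun x _ => by simp; rfl
  have pb : IsPrimitive b (fun t => -((2 * c)⁻¹ • ep t • (V t * u t))) := by
    refine ((isPrimitive_tail ip).map
      (((2 * c)⁻¹ • ContinuousLinearMap.id ℂ R).restrictScalars ℝ)).congr
        (fun x _ => by simp [hb]; rfl) fun x _ => by simp; rfl
  have dexp : ∀ (z : ℂ) (x : ℝ), HasDerivAt (fun x : ℝ => Complex.exp (z * x) • (1 : R))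
      ((z * Complex.exp (z * x)) • (1 : R)) x := fun z x => by
    have h1 : HasDerivAt (fun x : ℝ => Complex.exp (z * x)) (z * Complex.exp (z * x)) x := by
      have := ((Complex.ofRealCLM.hasDerivAt (x := x)).const_mul z).cexp
      simpa [mul_comm] using this
    simpa using h1.smul_const (1 : R)
  have pp : IsPrimitive (fun x => ep x • (1 : R)) (fun x => (c * ep x) • (1 : R)) :=
    .of_hasDerivWithinAt (by simp only [hep]; fun_prop) fun x _ => (dexp c x).hasDerivWithinAt
  have pm : IsPrimitive (fun x => em x • (1 : R)) (fun x => (-c * em x) • (1 : R)) := by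
    refine .of_hasDerivWithinAt (by simp only [hem]; fun_prop) fun x _ => ?_
    have := (dexp (-c) x).hasDerivWithinAt (s := Ici 0)
    simpa only [hem, neg_mul] using this
  have hu' : ∀ x, 0 ≤ x → u x = ep x • a x + em x • b x := by
    intro x hx
    rw [he x hx, volterra]
    simp only [ha, hb, smul_sub, ← hc]
    simp only [hep, hem, smul_smul, mul_comm]
    abel
  have ta : Tendsto a atTop (𝓝 1) := by
    have := ((tendsto_tail im).const_smul (2 * c)⁻¹).const_sub 1
    rwa [smul_zero, sub_zero] at this
  have tb : Tendsto (fun x => em x • em x • b x) atTop (𝓝 0) := by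
    have := ((tendsto_tail ip).const_smul (2 * c)⁻¹).norm
    rw [smul_zero, norm_zero] at this
    refine squeeze_zero_norm (fun x => ?_) this
    rw [norm_smul, norm_smul, show ‖em x‖ = 1 from norm_exp_neg_I_mul k x, one_mul, one_mul]
  clear_value a b
  -- The contributions of `a'` and `b'` to `u'` cancel, so `u'` has this form; differentiating once
  -- more, they add up to `V u`.
  refine ⟨u, fun x => c • (ep x • a x - em x • b x), ?_, ?_, ?_, ?_⟩
  · refine ((pp.mul pa).add (pm.mul pb)).congr (fun x hx => ?_) fun x hx => ?_
    · simp [hu' x hx]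
    · simp only [Pi.add_apply, smul_mul_assoc, one_mul]
      module
  · have := ((pp.mul pa).sub (pm.mul pb)).map
      ((c • ContinuousLinearMap.id ℂ R).restrictScalars ℝ)
    refine this.congr (fun x hx => ?_) fun x hx => ?_
    · simp
    · simp only [Pi.sub_apply, smul_mul_assoc, one_mul, ContinuousLinearMap.coe_restrictScalars',
        smul_apply, ContinuousLinearMap.id_apply]
      generalize hw : V x * u x = w
      rw [hu' x (le_of_lt hx), hc2]
      match_scalars
      · ring
      · field_simp
        linear_combination 2 * hpm x
      · ring
  · have := ta.add tb
    rw [add_zero] at this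
    refine this.congr' ?_
    filter_upwards [eventually_ge_atTop 0] with x hx
    change _ = em x • u x
    rw [hu' x hx, smul_add, smul_smul (em x) (ep x), hpm, one_smul]
  · have := (ta.sub tb).const_smul c
    rw [sub_zero] at this
    refine this.congr fun x => ?_
    change _ = em x • _
    rw [smul_comm (em x) c, smul_sub (em x), smul_smul (em x) (ep x), hpm, one_smul]

end Jost

end MatrixSchrodinger
namespace MatrixSchrodinger

/-! ### Solution pairs, Wronskians and Jost asymptotics. -/

section Solutions

variable {n : ℕ} {V W : ℝ → Matrix (Fin n) (Fin n) ℂ} {z : ℂ}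
  {u v f g f' g' p p' q q' : ℝ → Matrix (Fin n) (Fin n) ℂ}

/-- `v = u'` and `v' = V u - z u` in integrated form. -/
structure SolutionPair (V : ℝ → Matrix (Fin n) (Fin n) ℂ) (z : ℂ)
    (u v : ℝ → Matrix (Fin n) (Fin n) ℂ) : Prop where
  fst : IsPrimitive u v
  snd : IsPrimitive v (fun t => V t * u t - z • u t)

/-- `v = u'` and `v' = u V - z u` in integrated form. -/
structure LeftSolutionPair (V : ℝ → Matrix (Fin n) (Fin n) ℂ) (z : ℂ)
    (u v : ℝ → Matrix (Fin n) (Fin n) ℂ) : Prop where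
  fst : IsPrimitive u v
  snd : IsPrimitive v (fun t => u t * V t - z • u t)

theorem IsSolution.solutionPair {k : ℂ} (hV : IntegrableOn V (Ioi 0)) (h : IsSolution V k u) :
    SolutionPair V (k ^ 2) u (halfDeriv u) := by
  have hu := h.differentiableOn.continuousOn
  have h2 : IsPrimitive (halfDeriv u) (fun t => V t * u t - k ^ 2 • u t) := by
    refine ⟨fun x hx => ?_, h.halfDeriv_eq⟩
    have hu' : ContinuousOn u (uIcc 0 x) :=
      hu.mono (by rw [uIcc_of_le hx]; exact Icc_subset_Ici_self)
    have hVx : IntervalIntegrable V volume 0 x :=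
      (intervalIntegrable_iff_integrableOn_Ioc_of_le hx).2 (hV.mono_set Ioc_subset_Ioi_self)
    exact (hVx.mul_continuousOn hu').sub (hu'.const_smul (k ^ 2)).intervalIntegrable
  exact ⟨.of_hasDerivWithinAt h2.continuousOn fun x hx =>
    (h.differentiableOn x hx).hasDerivWithinAt, h2⟩

theorem SolutionPair.halfDeriv_eq (h : SolutionPair V z u v) {x : ℝ} (hx : 0 ≤ x) :
    halfDeriv u x = v x :=
  (h.fst.hasDerivWithinAt h.snd.continuousOn hx).derivWithin (uniqueDiffOn_Ici 0 x hx)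

theorem SolutionPair.isSolution {k : ℂ} (h : SolutionPair V (k ^ 2) u v) : IsSolution V k u := by
  refine ⟨fun x hx =>
    (h.fst.hasDerivWithinAt h.snd.continuousOn hx).differentiableWithinAt, fun x hx => ?_⟩
  rw [h.halfDeriv_eq hx, h.halfDeriv_eq le_rfl]
  exact h.snd.eq x hx

theorem SolutionPair.congr (h : SolutionPair V z u v) (hu : EqOn u f (Ici 0))
    (hv : EqOn v g (Ici 0)) : SolutionPair V z f g :=
  ⟨h.fst.congr hu (hv.mono Ioi_subset_Ici_self), h.snd.congr hv fun x hx => by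
    simp only [hu (Ioi_subset_Ici_self hx)]⟩

theorem SolutionPair.mul_const (h : SolutionPair V z u v) (C : Matrix (Fin n) (Fin n) ℂ) :
    SolutionPair V z (fun x => u x * C) (fun x => v x * C) := by
  refine ⟨(h.fst.mul (.const C)).congr (fun x _ => rfl) fun x _ => by simp,
    (h.snd.mul (.const C)).congr (fun x _ => rfl) fun x _ => ?_⟩
  simp [sub_mul, mul_assoc]

theorem SolutionPair.sub (h : SolutionPair V z u v) (h' : SolutionPair V z f g) :
    SolutionPair V z (fun x => u x - f x) (fun x => v x - g x) := by
  refine ⟨h.fst.sub h'.fst, (h.snd.sub h'.snd).congr (fun x _ => rfl) fun x _ => ?_⟩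
  simp only [Pi.sub_apply, mul_sub, smul_sub]
  abel

/-- Lets the free physical solution be the left factor of a Wronskian without an adjoint. -/
theorem SolutionPair.leftSolutionPair_of_zero (h : SolutionPair 0 z u v) :
    LeftSolutionPair 0 z u v :=
  ⟨h.fst, by simpa using h.snd⟩

/-- The adjoint reverses products, so a self-adjoint `V` moves to the right of the solution. -/
theorem SolutionPair.conjTranspose (hV : ∀ x, 0 < x → (V x)ᴴ = V x)
    (h : SolutionPair V z u v) :
    LeftSolutionPair V (star z) (fun x => (u x)ᴴ) (fun x => (v x)ᴴ) := by
  let L : Matrix (Fin n) (Fin n) ℂ →L[ℝ] Matrix (Fin n) (Fin n) ℂ :=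
    (starL' ℝ : Matrix (Fin n) (Fin n) ℂ ≃L[ℝ] Matrix (Fin n) (Fin n) ℂ)
  refine ⟨h.fst.map L, (h.snd.map L).congr (fun x _ => rfl) fun x hx => ?_⟩
  change (V x * u x - z • u x)ᴴ = _
  rw [Matrix.conjTranspose_sub, Matrix.conjTranspose_mul, hV x hx, Matrix.conjTranspose_smul]

/-- The Wronskian identity. -/
theorem LeftSolutionPair.isPrimitive_wronskian (hp : LeftSolutionPair W z p p')
    (hq : SolutionPair V z q q') :
    IsPrimitive (fun x => p x * q' x - p' x * q x) (fun x => p x * (V x - W x) * q x) := by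
  refine ((hp.fst.mul hq.snd).sub (hp.snd.mul hq.fst)).congr (fun x _ => rfl) fun x _ => ?_
  simp only [Pi.sub_apply, mul_sub, sub_mul, smul_mul_assoc, mul_smul_comm, mul_assoc]
  abel

/-- For real `z` the adjoint solves the left equation with the same potential, so the density in the
Wronskian identity is zero. -/
theorem wronskian_conjTranspose_eq (hV : ∀ x, 0 < x → (V x)ᴴ = V x) (hz : star z = z)
    (hp : SolutionPair V z p p') (hq : SolutionPair V z q q') {x : ℝ} (hx : 0 ≤ x) :
    (p x)ᴴ * q' x - (p' x)ᴴ * q x = (p 0)ᴴ * q' 0 - (p' 0)ᴴ * q 0 := by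
  have h := hp.conjTranspose hV
  rw [hz] at h
  exact (h.isPrimitive_wronskian hq).eq_apply_zero (fun x _ => by simp) hx

/-- The asymptotics `u ~ e^{ikx}`, `v ~ i k e^{ikx}` of a Jost solution and its derivative. -/
structure JostAsymptotics (k : ℝ) (u v : ℝ → Matrix (Fin n) (Fin n) ℂ) : Prop where
  fst : Tendsto (fun x : ℝ => Complex.exp (-(Complex.I * k * x)) • u x) atTop (𝓝 1)
  snd : Tendsto (fun x : ℝ => Complex.exp (-(Complex.I * k * x)) • v x) atTop
    (𝓝 ((Complex.I * k) • (1 : Matrix (Fin n) (Fin n) ℂ)))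

variable {k : ℝ}

theorem star_exp_neg (k x : ℝ) :
    star (Complex.exp (-(Complex.I * k * x))) = Complex.exp (Complex.I * k * x) := by
  rw [← starRingEnd_apply, ← Complex.exp_conj]
  simp

theorem exp_mul_exp_neg (k x : ℝ) :
    Complex.exp (Complex.I * k * x) * Complex.exp (-(Complex.I * k * x)) = 1 := by
  rw [← Complex.exp_add, add_neg_cancel, Complex.exp_zero]

/-- The phases of `f†` and `g` cancel. Only asymptotics enter, so `f` and `g` may belong to
different potentials; the comparison of free and perturbed solutions relies on this. -/
theorem JostAsymptotics.wronskian_self (hf : JostAsymptotics k f f')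
    (hg : JostAsymptotics k g g') :
    Tendsto (fun x => (f x)ᴴ * g' x - (f' x)ᴴ * g x) atTop
      (𝓝 ((2 * (Complex.I * k)) • (1 : Matrix (Fin n) (Fin n) ℂ))) := by
  have h := (hf.fst.star.mul hg.snd).sub (hf.snd.star.mul hg.fst)
  have e : star (1 : Matrix (Fin n) (Fin n) ℂ) *
      ((Complex.I * k) • (1 : Matrix (Fin n) (Fin n) ℂ)) -
      star ((Complex.I * k) • (1 : Matrix (Fin n) (Fin n) ℂ)) * 1 =
      (2 * (Complex.I * k)) • (1 : Matrix (Fin n) (Fin n) ℂ) := by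
    rw [star_smul, star_one, one_mul, mul_one, ← sub_smul]
    congr 1
    simp only [star_mul', RCLike.star_def, Complex.conj_I, Complex.conj_ofReal]
    ring
  rw [e] at h
  refine h.congr fun x => ?_
  simp only [star_smul, smul_mul_smul_comm, star_exp_neg, exp_mul_exp_neg, one_smul]
  rfl

/-- The phases do not cancel here, but they have modulus one, and the amplitudes tend to `-ik + ik =
0`. -/
theorem JostAsymptotics.wronskian_neg (hf : JostAsymptotics k f f')
    (hg : JostAsymptotics (-k) g g') :
    Tendsto (fun x => (f x)ᴴ * g' x - (f' x)ᴴ * g x) atTop (𝓝 0) := by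
  have h := (hf.fst.star.mul hg.snd).sub (hf.snd.star.mul hg.fst)
  have e : star (1 : Matrix (Fin n) (Fin n) ℂ) *
      ((Complex.I * (-k : ℝ)) • (1 : Matrix (Fin n) (Fin n) ℂ)) -
      star ((Complex.I * k) • (1 : Matrix (Fin n) (Fin n) ℂ)) * 1 = 0 := by
    rw [star_smul, star_one, one_mul, mul_one, ← sub_smul]
    simp
  rw [e] at h
  have h' := h.norm
  rw [norm_zero] at h'
  refine squeeze_zero_norm (fun x => le_of_eq ?_) h'
  simp only [star_smul, smul_mul_smul_comm, star_exp_neg, ← smul_sub, norm_smul, norm_mul,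
    norm_exp_I_mul, norm_exp_neg_I_mul, one_mul]
  rfl

theorem JostAsymptotics.exists_bound (hf : JostAsymptotics k u v) (hu : ContinuousOn u (Ici 0)) :
    ∃ C, ∀ x, 0 ≤ x → ‖u x‖ ≤ C := by
  obtain ⟨D, hD⟩ := hf.fst.norm.isBoundedUnder_le.eventually_le
  obtain ⟨a, ha⟩ := hD.exists_forall_of_atTop
  obtain ⟨C, hC⟩ := (isCompact_Icc (a := (0 : ℝ)) (b := a)).exists_bound_of_continuousOn
    (hu.mono Icc_subset_Ici_self)
  refine ⟨max C D, fun x hx => ?_⟩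
  rcases le_total x a with h | h
  · exact (hC x ⟨hx, h⟩).trans (le_max_left _ _)
  · refine le_trans (le_of_eq ?_) ((ha x h).trans (le_max_right _ _))
    rw [norm_smul, norm_exp_neg_I_mul, one_mul]

theorem IsJostSolution.jostAsymptotics (h : IsJostSolution V (k : ℂ) u) :
    JostAsymptotics k u (halfDeriv u) := ⟨h.tendsto, h.tendsto_deriv⟩

theorem exists_isJostSolution (hV : IntegrableOn V (Ioi 0)) (hk : k ≠ 0) :
    ∃ u, IsJostSolution V (k : ℂ) u := by
  obtain ⟨u, v, h1, h2, h3, h4⟩ := exists_jost hV hk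
  have h : SolutionPair V ((k : ℂ) ^ 2) u v := ⟨h1, h2⟩
  refine ⟨u, h.isSolution, h3, h4.congr' ?_⟩
  filter_upwards [eventually_ge_atTop 0] with x hx
  rw [h.halfDeriv_eq hx]

theorem isJostSolution_jostSolution (hV : IntegrableOn V (Ioi 0)) (hk : k ≠ 0) :
    IsJostSolution V (k : ℂ) (jostSolution V k) :=
  Classical.epsilon_spec (exists_isJostSolution hV hk)

end Solutions

/-! ### Linear algebra of Wronskian matrices. -/

section Algebra

variable {m R : Type*} [Fintype m] [DecidableEq m] [Field R] [StarRing R]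
  {F G F' G' : Matrix m m R} {c : R}

/-- If the constant Wronskians of two pairs form the diagonal matrix `diag (c, -c)`, then every pair
is recovered from its Wronskians with them. -/
theorem eq_of_wronskians (hc : c ≠ 0) (h11 : Fᴴ * F' - F'ᴴ * F = c • 1)
    (h12 : Fᴴ * G' - F'ᴴ * G = 0) (h21 : Gᴴ * F' - G'ᴴ * F = 0)
    (h22 : Gᴴ * G' - G'ᴴ * G = (-c) • 1) (P P' : Matrix m m R) :
    c • P = F * (Fᴴ * P' - F'ᴴ * P) - G * (Gᴴ * P' - G'ᴴ * P) ∧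
      c • P' = F' * (Fᴴ * P' - F'ᴴ * P) - G' * (Gᴴ * P' - G'ᴴ * P) := by
  have hL : Matrix.fromBlocks (-F'ᴴ) Fᴴ (G'ᴴ) (-Gᴴ) * Matrix.fromBlocks F G F' G' =
      c • (1 : Matrix (m ⊕ m) (m ⊕ m) R) := by
    rw [Matrix.fromBlocks_multiply, ← Matrix.fromBlocks_one, Matrix.fromBlocks_smul, smul_zero]
    congr 1
    · rw [← h11]; noncomm_ring
    · rw [← h12]; noncomm_ring
    · rw [← neg_eq_zero, ← h21]; noncomm_ring
    · rw [← neg_inj, ← neg_smul, ← h22]; noncomm_ring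
  -- The hypotheses give a left inverse, up to `c`, of the square block matrix. It is also a right
  -- inverse, whose top and bottom rows applied to `(P, P')` are the two claims.
  have hR : Matrix.fromBlocks F G F' G' * Matrix.fromBlocks (-F'ᴴ) Fᴴ (G'ᴴ) (-Gᴴ) =
      c • (1 : Matrix (m ⊕ m) (m ⊕ m) R) := by
    have h1 : (c⁻¹ • Matrix.fromBlocks (-F'ᴴ) Fᴴ (G'ᴴ) (-Gᴴ)) * Matrix.fromBlocks F G F' G' = 1 := by
      rw [smul_mul_assoc, hL, smul_smul, inv_mul_cancel₀ hc, one_smul]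
    have h2 := mul_eq_one_comm.1 h1
    rw [mul_smul_comm] at h2
    rw [← h2, smul_smul, mul_inv_cancel₀ hc, one_smul]
  rw [Matrix.fromBlocks_multiply, ← Matrix.fromBlocks_one, Matrix.fromBlocks_smul, smul_zero,
    Matrix.fromBlocks_inj] at hR
  obtain ⟨e11, e12, e21, e22⟩ := hR
  constructor
  · calc c • P = (c • 1) * P + 0 * P' := by simp
      _ = _ := by rw [← e11, ← e12]; noncomm_ring
  · calc c • P' = 0 * P + (c • 1) * P' := by simp
      _ = _ := by rw [← e21, ← e22]; noncomm_ring

end Algebra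

/-! ### The Jost solutions at `k` and `-k` as a basis. -/

section JostPair

variable {n : ℕ} {V : ℝ → Matrix (Fin n) (Fin n) ℂ} {k : ℝ}
  {f g p f' g' p' : ℝ → Matrix (Fin n) (Fin n) ℂ}

theorem star_ofReal_sq (k : ℝ) : star ((k : ℂ) ^ 2) = (k : ℂ) ^ 2 := by simp

/-- The constant Wronskians of the Jost solutions at `k` and `-k`. -/
theorem jost_wronskians (hV : ∀ x, 0 < x → (V x)ᴴ = V x)
    (hf : SolutionPair V ((k : ℂ) ^ 2) f f') (hfa : JostAsymptotics k f f')
    (hg : SolutionPair V ((k : ℂ) ^ 2) g g') (hga : JostAsymptotics (-k) g g')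
    {x : ℝ} (hx : 0 ≤ x) :
    (f x)ᴴ * f' x - (f' x)ᴴ * f x = (2 * (Complex.I * k)) • 1 ∧
    (f x)ᴴ * g' x - (f' x)ᴴ * g x = 0 ∧ (g x)ᴴ * f' x - (g' x)ᴴ * f x = 0 ∧
    (g x)ᴴ * g' x - (g' x)ᴴ * g x = (-(2 * (Complex.I * k))) • 1 := by
  have key : ∀ {p p' q q' : ℝ → Matrix (Fin n) (Fin n) ℂ} {l : Matrix (Fin n) (Fin n) ℂ},
      SolutionPair V ((k : ℂ) ^ 2) p p' → SolutionPair V ((k : ℂ) ^ 2) q q' →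
      Tendsto (fun x => (p x)ᴴ * q' x - (p' x)ᴴ * q x) atTop (𝓝 l) →
      (p x)ᴴ * q' x - (p' x)ᴴ * q x = l := by
    intro p p' q q' l hp hq hl
    have hc : ∀ y, 0 ≤ y → (p y)ᴴ * q' y - (p' y)ᴴ * q y = (p x)ᴴ * q' x - (p' x)ᴴ * q x :=
      fun y hy => by
        rw [wronskian_conjTranspose_eq hV (star_ofReal_sq k) hp hq hy,
          wronskian_conjTranspose_eq hV (star_ofReal_sq k) hp hq hx]
    refine tendsto_nhds_unique (tendsto_const_nhds.congr' ?_) hl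
    filter_upwards [eventually_ge_atTop 0] with y hy
    exact (hc y hy).symm
  refine ⟨key hf hf (hfa.wronskian_self hfa), key hf hg (hfa.wronskian_neg hga),
    key hg hf (hga.wronskian_neg (by rwa [neg_neg])), ?_⟩
  have := key hg hg (hga.wronskian_self hga)
  rw [this]
  congr 1
  push_cast
  ring

/-- Every solution is a combination of the Jost solutions at `k` and `-k`. -/
theorem eq_jost_combination (hV : ∀ x, 0 < x → (V x)ᴴ = V x) (hk : k ≠ 0)
    (hf : SolutionPair V ((k : ℂ) ^ 2) f f') (hfa : JostAsymptotics k f f')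
    (hg : SolutionPair V ((k : ℂ) ^ 2) g g') (hga : JostAsymptotics (-k) g g')
    (hp : SolutionPair V ((k : ℂ) ^ 2) p p') {x : ℝ} (hx : 0 ≤ x) :
    (2 * (Complex.I * k)) • p x = f x * ((f 0)ᴴ * p' 0 - (f' 0)ᴴ * p 0) -
        g x * ((g 0)ᴴ * p' 0 - (g' 0)ᴴ * p 0) ∧
      (2 * (Complex.I * k)) • p' x = f' x * ((f 0)ᴴ * p' 0 - (f' 0)ᴴ * p 0) -
        g' x * ((g 0)ᴴ * p' 0 - (g' 0)ᴴ * p 0) := by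
  obtain ⟨h11, h12, h21, h22⟩ := jost_wronskians hV hf hfa hg hga hx
  rw [← wronskian_conjTranspose_eq hV (star_ofReal_sq k) hf hp hx,
    ← wronskian_conjTranspose_eq hV (star_ofReal_sq k) hg hp hx]
  exact eq_of_wronskians (by simp [hk]) h11 h12 h21 h22 _ _

/-- Uniqueness of the Jost solution. -/
theorem jost_unique (hV : ∀ x, 0 < x → (V x)ᴴ = V x) (hk : k ≠ 0)
    (hf : SolutionPair V ((k : ℂ) ^ 2) f f') (hfa : JostAsymptotics k f f')
    (hg : SolutionPair V ((k : ℂ) ^ 2) g g') (hga : JostAsymptotics (-k) g g')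
    (hp : SolutionPair V ((k : ℂ) ^ 2) p p') (hpa : JostAsymptotics k p p') {x : ℝ} (hx : 0 ≤ x) :
    p x = f x ∧ p' x = f' x := by
  have hc : 2 * (Complex.I * (k : ℂ)) ≠ 0 := by simp [hk]
  -- The coefficients of `p` along `f` and `g` are constant Wronskians, which the asymptotics of `p`
  -- determine as `2ik` and `0`.
  obtain ⟨h1, h2⟩ := eq_jost_combination hV hk hf hfa hg hga hp hx
  obtain ⟨-, -, e1, -⟩ := jost_wronskians hV hp hpa hg hga (x := 0) le_rfl
  have e2 : (f 0)ᴴ * p' 0 - (f' 0)ᴴ * p 0 = (2 * (Complex.I * k)) • 1 := by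
    obtain ⟨h3, -⟩ := jost_wronskians hV hf hfa hg hga (x := 0) le_rfl
    have h4 := tendsto_nhds_unique (tendsto_const_nhds.congr' (by
      filter_upwards [eventually_ge_atTop 0] with y hy
      exact (wronskian_conjTranspose_eq hV (star_ofReal_sq k) hf hp hy).symm))
      (hfa.wronskian_self hpa)
    exact h4
  rw [e1, e2, mul_zero, sub_zero, mul_smul_comm, mul_one] at h1 h2
  exact ⟨smul_right_injective _ hc h1, smul_right_injective _ hc h2⟩

/-- No separate initial value theory is needed: the Jost solutions at `k` and `-k` span all initial
data, with coefficients given by `eq_of_wronskians` at `0`. -/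
theorem exists_isRegularSolution (hVi : IntegrableOn V (Ioi 0)) (hV : ∀ x, 0 < x → (V x)ᴴ = V x)
    (hk : k ≠ 0) (A B : Matrix (Fin n) (Fin n) ℂ) :
    ∃ u, IsRegularSolution V A B (k : ℂ) u := by
  have hc : 2 * (Complex.I * (k : ℂ)) ≠ 0 := by simp [hk]
  have hf := isJostSolution_jostSolution hVi hk
  have hg := isJostSolution_jostSolution hVi (neg_ne_zero.2 hk)
  have hfs := hf.isSolution.solutionPair hVi
  have hgs := hg.isSolution.solutionPair hVi
  rw [Complex.ofReal_neg, neg_sq] at hgs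
  set f := jostSolution V (k : ℂ)
  rw [← Complex.ofReal_neg] at hgs
  set g := jostSolution V ((-k : ℝ) : ℂ)
  obtain ⟨h11, h12, h21, h22⟩ := jost_wronskians hV hfs hf.jostAsymptotics hgs hg.jostAsymptotics
    (x := 0) le_rfl
  obtain ⟨h1, h2⟩ := eq_of_wronskians hc h11 h12 h21 h22 A B
  have hs := (hfs.mul_const ((2 * (Complex.I * (k : ℂ)))⁻¹ •
    ((f 0)ᴴ * B - (halfDeriv f 0)ᴴ * A))).sub (hgs.mul_const ((2 * (Complex.I * (k : ℂ)))⁻¹ •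
    ((g 0)ᴴ * B - (halfDeriv g 0)ᴴ * A)))
  refine ⟨_, hs.isSolution, ?_, ?_⟩
  · rw [mul_smul_comm, mul_smul_comm, ← smul_sub, ← h1, smul_smul, inv_mul_cancel₀ hc, one_smul]
  · rw [hs.halfDeriv_eq le_rfl, mul_smul_comm, mul_smul_comm, ← smul_sub, ← h2, smul_smul,
      inv_mul_cancel₀ hc, one_smul]

theorem isRegularSolution_regularSolution (hVi : IntegrableOn V (Ioi 0))
    (hV : ∀ x, 0 < x → (V x)ᴴ = V x) (hk : k ≠ 0) (A B : Matrix (Fin n) (Fin n) ℂ) :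
    IsRegularSolution V A B (k : ℂ) (regularSolution V A B k) :=
  Classical.epsilon_spec (exists_isRegularSolution hVi hV hk A B)

end JostPair

end MatrixSchrodinger
namespace MatrixSchrodinger

/-! ### The Jost matrix and the physical solution. -/

section JostMatrix

variable {n : ℕ} {V : ℝ → Matrix (Fin n) (Fin n) ℂ} {A B : Matrix (Fin n) (Fin n) ℂ} {k : ℝ}

theorem solutionPair_jostSolution (hVi : IntegrableOn V (Ioi 0)) (hk : k ≠ 0) :
    SolutionPair V ((k : ℂ) ^ 2) (jostSolution V k) (halfDeriv (jostSolution V k)) :=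
  (isJostSolution_jostSolution hVi hk).isSolution.solutionPair hVi

theorem solutionPair_jostSolution_neg (hVi : IntegrableOn V (Ioi 0)) (hk : k ≠ 0) :
    SolutionPair V ((k : ℂ) ^ 2) (jostSolution V (-(k : ℂ)))
      (halfDeriv (jostSolution V (-(k : ℂ)))) := by
  have h := solutionPair_jostSolution hVi (neg_ne_zero.2 hk)
  rwa [Complex.ofReal_neg, neg_sq] at h

theorem jostAsymptotics_jostSolution (hVi : IntegrableOn V (Ioi 0)) (hk : k ≠ 0) :
    JostAsymptotics k (jostSolution V k) (halfDeriv (jostSolution V k)) :=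
  (isJostSolution_jostSolution hVi hk).jostAsymptotics

theorem jostAsymptotics_jostSolution_neg (hVi : IntegrableOn V (Ioi 0)) (hk : k ≠ 0) :
    JostAsymptotics (-k) (jostSolution V (-(k : ℂ))) (halfDeriv (jostSolution V (-(k : ℂ)))) := by
  have h := jostAsymptotics_jostSolution hVi (neg_ne_zero.2 hk)
  rwa [Complex.ofReal_neg] at h

theorem jostMatrix_eq (hVi : IntegrableOn V (Ioi 0)) (hV : ∀ x, 0 < x → (V x)ᴴ = V x)
    (hk : k ≠ 0) :
    jostMatrix V A B k = (jostSolution V (-(k : ℂ)) 0)ᴴ * B -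
      (halfDeriv (jostSolution V (-(k : ℂ))) 0)ᴴ * A := by
  have hφ := isRegularSolution_regularSolution hVi hV hk A B
  rw [jostMatrix, wronskian, hφ.apply_zero, hφ.deriv_zero, Complex.conj_ofReal]
  congr 2
  exact derivWithin.star

theorem jostMatrix_neg_eq (hVi : IntegrableOn V (Ioi 0)) (hV : ∀ x, 0 < x → (V x)ᴴ = V x)
    (hk : k ≠ 0) :
    jostMatrix V A B (-(k : ℂ)) = (jostSolution V k 0)ᴴ * B -
      (halfDeriv (jostSolution V k) 0)ᴴ * A := by
  have h := jostMatrix_eq (A := A) (B := B) hVi hV (neg_ne_zero.2 hk)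
  rwa [Complex.ofReal_neg, neg_neg] at h

/-- The regular solution and its derivative in terms of the Jost solutions. -/
theorem regularSolution_eq (hVi : IntegrableOn V (Ioi 0)) (hV : ∀ x, 0 < x → (V x)ᴴ = V x)
    (hk : k ≠ 0) {x : ℝ} (hx : 0 ≤ x) :
    (2 * (Complex.I * k)) • regularSolution V A B k x =
        jostSolution V k x * jostMatrix V A B (-(k : ℂ)) -
          jostSolution V (-(k : ℂ)) x * jostMatrix V A B k ∧
      (2 * (Complex.I * k)) • halfDeriv (regularSolution V A B k) x =
        halfDeriv (jostSolution V k) x * jostMatrix V A B (-(k : ℂ)) -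
          halfDeriv (jostSolution V (-(k : ℂ))) x * jostMatrix V A B k := by
  have hφ := isRegularSolution_regularSolution hVi hV hk A B
  have h := eq_jost_combination hV hk (solutionPair_jostSolution hVi hk)
    (jostAsymptotics_jostSolution hVi hk) (solutionPair_jostSolution_neg hVi hk)
    (jostAsymptotics_jostSolution_neg hVi hk) (hφ.isSolution.solutionPair hVi) hx
  rwa [hφ.apply_zero, hφ.deriv_zero, ← jostMatrix_eq hVi hV hk, ← jostMatrix_neg_eq hVi hV hk] at h

/-- Expand `A` and `B` in Jost data at `0` and insert this in `A†B - B†A = 0`. The mixed Wronskians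
vanish and the other two are `c` and `-c`, which leaves the difference of the two sides. For
invertible `J(k)` this is unitarity of `S`. -/
theorem jostMatrix_conjTranspose_mul_self (hVi : IntegrableOn V (Ioi 0))
    (hV : ∀ x, 0 < x → (V x)ᴴ = V x) (hAB : -(Bᴴ * A) + Aᴴ * B = 0) (hk : k ≠ 0) :
    (jostMatrix V A B (-(k : ℂ)))ᴴ * jostMatrix V A B (-(k : ℂ)) =
      (jostMatrix V A B k)ᴴ * jostMatrix V A B k := by
  have hφ := isRegularSolution_regularSolution hVi hV hk A B
  have hc : 2 * (Complex.I * (k : ℂ)) ≠ 0 := by simp [hk]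
  obtain ⟨eA, eB⟩ := regularSolution_eq (A := A) (B := B) hVi hV hk (x := 0) le_rfl
  rw [hφ.apply_zero] at eA
  rw [hφ.deriv_zero] at eB
  obtain ⟨h11, h12, h21, h22⟩ := jost_wronskians hV (solutionPair_jostSolution hVi hk)
    (jostAsymptotics_jostSolution hVi hk) (solutionPair_jostSolution_neg hVi hk)
    (jostAsymptotics_jostSolution_neg hVi hk) (x := 0) le_rfl
  generalize jostMatrix V A B k = P at *
  generalize jostMatrix V A B (-(k : ℂ)) = Q at *
  generalize 2 * (Complex.I * (k : ℂ)) = c at *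
  generalize jostSolution V k 0 = F at *
  generalize jostSolution V (-(k : ℂ)) 0 = G at *
  generalize halfDeriv (jostSolution V k) 0 = F' at *
  generalize halfDeriv (jostSolution V (-(k : ℂ))) 0 = G' at *
  have h0 : (c • A)ᴴ * (c • B) - (c • B)ᴴ * (c • A) = 0 := by
    rw [Matrix.conjTranspose_smul, Matrix.conjTranspose_smul, smul_mul_smul_comm,
      smul_mul_smul_comm, ← smul_sub, sub_eq_neg_add, hAB, smul_zero]
  have h1 : (c • A)ᴴ * (c • B) - (c • B)ᴴ * (c • A) = Qᴴ * (Fᴴ * F' - F'ᴴ * F) * Q -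
      Qᴴ * (Fᴴ * G' - F'ᴴ * G) * P - Pᴴ * (Gᴴ * F' - G'ᴴ * F) * Q +
      Pᴴ * (Gᴴ * G' - G'ᴴ * G) * P := by
    rw [eA, eB]
    simp only [Matrix.conjTranspose_sub, Matrix.conjTranspose_mul]
    noncomm_ring
  rw [h0, h11, h12, h21, h22] at h1
  have h2 : c • (Qᴴ * Q - Pᴴ * P) = 0 := by
    rw [h1]
    simp [sub_eq_add_neg]
  exact sub_eq_zero.1 ((smul_eq_zero.1 h2).resolve_left hc)

/-- By the previous identity `J(k)` and `J(-k)` have the same kernel. A vector in it is annihilated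
by `A` and `B`, which are combinations of the two, and so by `A†A + B†B`. -/
theorem isUnit_jostMatrix (hVi : IntegrableOn V (Ioi 0)) (hV : ∀ x, 0 < x → (V x)ᴴ = V x)
    (hAB : -(Bᴴ * A) + Aᴴ * B = 0) (hAB_pos : (Aᴴ * A + Bᴴ * B).PosDef) (hk : k ≠ 0) :
    IsUnit (jostMatrix V A B k) := by
  have hφ := isRegularSolution_regularSolution hVi hV hk A B
  have hc : 2 * (Complex.I * (k : ℂ)) ≠ 0 := by simp [hk]
  obtain ⟨eA, eB⟩ := regularSolution_eq (A := A) (B := B) hVi hV hk (x := 0) le_rfl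
  rw [hφ.apply_zero] at eA
  rw [hφ.deriv_zero] at eB
  have hJ := jostMatrix_conjTranspose_mul_self hVi hV hAB hk
  rw [← Matrix.mulVec_injective_iff_isUnit]
  refine (injective_iff_map_eq_zero (Matrix.mulVecLin (jostMatrix V A B k))).2 fun v hv => ?_
  rw [Matrix.mulVecLin_apply] at hv
  have hv' : jostMatrix V A B (-(k : ℂ)) *ᵥ v = 0 := by
    rw [← Matrix.conjTranspose_mul_self_mulVec_eq_zero, hJ,
      Matrix.conjTranspose_mul_self_mulVec_eq_zero, hv]
  have key : ∀ {M F G : Matrix (Fin n) (Fin n) ℂ}, (2 * (Complex.I * (k : ℂ))) • M =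
      F * jostMatrix V A B (-(k : ℂ)) - G * jostMatrix V A B k → M *ᵥ v = 0 := by
    intro M F G h
    have h1 : (2 * (Complex.I * (k : ℂ))) • (M *ᵥ v) = 0 := by
      rw [← Matrix.smul_mulVec, h, Matrix.sub_mulVec, ← Matrix.mulVec_mulVec,
        ← Matrix.mulVec_mulVec, hv, hv', Matrix.mulVec_zero, Matrix.mulVec_zero, sub_zero]
    exact (smul_eq_zero.1 h1).resolve_left hc
  by_contra hne
  have hpos := hAB_pos.dotProduct_mulVec_pos hne
  rw [Matrix.add_mulVec, ← Matrix.mulVec_mulVec, ← Matrix.mulVec_mulVec, key eA, key eB] at hpos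
  simp at hpos

/-- The derivative of the physical solution. -/
noncomputable def physicalDeriv (V : ℝ → Matrix (Fin n) (Fin n) ℂ)
    (A B : Matrix (Fin n) (Fin n) ℂ) (k : ℂ) (x : ℝ) : Matrix (Fin n) (Fin n) ℂ :=
  (-(Complex.I * k)) • (halfDeriv (regularSolution V A B k) x * (jostMatrix V A B k)⁻¹)

theorem solutionPair_physicalSolution (hVi : IntegrableOn V (Ioi 0))
    (hV : ∀ x, 0 < x → (V x)ᴴ = V x) (hk : k ≠ 0) :
    SolutionPair V ((k : ℂ) ^ 2) (physicalSolution V A B k) (physicalDeriv V A B k) := by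
  have h := ((isRegularSolution_regularSolution hVi hV hk A B).isSolution.solutionPair
    hVi).mul_const ((-(Complex.I * k)) • (jostMatrix V A B k)⁻¹)
  simp only [mul_smul_comm] at h
  exact h

/-- The physical solution in terms of the Jost solutions and the scattering matrix. -/
theorem physicalSolution_eq (hVi : IntegrableOn V (Ioi 0)) (hV : ∀ x, 0 < x → (V x)ᴴ = V x)
    (hk : k ≠ 0) (hJ : IsUnit (jostMatrix V A B k)) {x : ℝ} (hx : 0 ≤ x) :
    physicalSolution V A B k x = (2⁻¹ : ℂ) • (jostSolution V k x * scatteringMatrix V A B k +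
        jostSolution V (-(k : ℂ)) x) ∧
      physicalDeriv V A B k x = (2⁻¹ : ℂ) • (halfDeriv (jostSolution V k) x *
        scatteringMatrix V A B k + halfDeriv (jostSolution V (-(k : ℂ))) x) := by
  have hJ' : jostMatrix V A B k * (jostMatrix V A B k)⁻¹ = 1 :=
    Matrix.mul_nonsing_inv _ ((Matrix.isUnit_iff_isUnit_det _).1 hJ)
  have key : ∀ {M F G : Matrix (Fin n) (Fin n) ℂ}, (2 * (Complex.I * (k : ℂ))) • M =
      F * jostMatrix V A B (-(k : ℂ)) - G * jostMatrix V A B k →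
      (-(Complex.I * k)) • (M * (jostMatrix V A B k)⁻¹) =
        (2⁻¹ : ℂ) • (F * scatteringMatrix V A B k + G) := by
    intro M F G h
    have h1 : (-(Complex.I * k)) • (M * (jostMatrix V A B k)⁻¹) =
        (-2⁻¹ : ℂ) • (((2 * (Complex.I * (k : ℂ))) • M) * (jostMatrix V A B k)⁻¹) := by
      rw [smul_mul_assoc, smul_smul]
      congr 1
      ring
    rw [h1, h, sub_mul, mul_assoc G, hJ', mul_one, scatteringMatrix, neg_smul, ← smul_neg,
      mul_neg, mul_assoc F]
    congr 1
    abel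
  obtain ⟨h1, h2⟩ := regularSolution_eq (A := A) (B := B) hVi hV hk hx
  exact ⟨key h1, key h2⟩

theorem exists_bound_physicalSolution (hVi : IntegrableOn V (Ioi 0))
    (hV : ∀ x, 0 < x → (V x)ᴴ = V x) (hk : k ≠ 0) (hJ : IsUnit (jostMatrix V A B k)) :
    ∃ C, ∀ x, 0 ≤ x → ‖physicalSolution V A B k x‖ ≤ C := by
  obtain ⟨C, hC⟩ := (jostAsymptotics_jostSolution hVi hk).exists_bound
    (solutionPair_jostSolution hVi hk).fst.continuousOn
  obtain ⟨D, hD⟩ := (jostAsymptotics_jostSolution_neg hVi hk).exists_bound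
    (solutionPair_jostSolution_neg hVi hk).fst.continuousOn
  refine ⟨‖(2⁻¹ : ℂ)‖ * (C * ‖scatteringMatrix V A B k‖ + D), fun x hx => ?_⟩
  rw [(physicalSolution_eq hVi hV hk hJ hx).1, norm_smul]
  refine mul_le_mul_of_nonneg_left ((norm_add_le _ _).trans (add_le_add ((norm_mul_le _ _).trans
    (mul_le_mul_of_nonneg_right (hC x hx) (norm_nonneg _))) (hD x hx))) (norm_nonneg _)

end JostMatrix

/-! ### The case of zero potential. -/

section Free

variable {n : ℕ} {A B : Matrix (Fin n) (Fin n) ℂ} {k : ℝ}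

theorem solutionPair_exp (n : ℕ) (k : ℝ) :
    SolutionPair (n := n) 0 ((k : ℂ) ^ 2) (fun x => Complex.exp (Complex.I * k * x) • 1)
      (fun x => (Complex.I * k) • Complex.exp (Complex.I * k * x) • 1) := by
  have hd : ∀ x : ℝ, HasDerivAt
      (fun x : ℝ => Complex.exp (Complex.I * k * x) • (1 : Matrix (Fin n) (Fin n) ℂ))
      ((Complex.I * k) • Complex.exp (Complex.I * k * x) • 1) x := fun x => by
    have h1 : HasDerivAt (fun x : ℝ => Complex.exp (Complex.I * k * x))
        (Complex.I * k * Complex.exp (Complex.I * k * x)) x := by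
      have := ((Complex.ofRealCLM.hasDerivAt (x := x)).const_mul (Complex.I * (k : ℂ))).cexp
      simpa [mul_comm] using this
    rw [smul_smul]
    exact h1.smul_const _
  have hc : Continuous fun x : ℝ =>
      Complex.exp (Complex.I * k * x) • (1 : Matrix (Fin n) (Fin n) ℂ) :=
    (continuous_exp_I_mul k).smul continuous_const
  have h2 : ∀ x : ℝ, (0 : ℝ → Matrix (Fin n) (Fin n) ℂ) x *
      Complex.exp (Complex.I * k * x) • (1 : Matrix (Fin n) (Fin n) ℂ) -
      (k : ℂ) ^ 2 • Complex.exp (Complex.I * k * x) • (1 : Matrix (Fin n) (Fin n) ℂ) =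
      (Complex.I * k) • (Complex.I * k) • Complex.exp (Complex.I * k * x) • 1 := fun x => by
    rw [Pi.zero_apply, zero_mul, zero_sub, ← neg_smul, smul_smul (Complex.I * k) (Complex.I * k)]
    congr 1
    linear_combination (-(k : ℂ) ^ 2) * Complex.I_sq
  refine ⟨.of_hasDerivWithinAt (hc.const_smul (Complex.I * (k : ℂ))).continuousOn fun x _ =>
    (hd x).hasDerivWithinAt, ?_⟩
  simp only [h2]
  exact .of_hasDerivWithinAt ((hc.const_smul (Complex.I * (k : ℂ))).const_smul (Complex.I * (k : ℂ))).continuousOn fun x _ =>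
    ((hd x).const_smul (Complex.I * (k : ℂ))).hasDerivWithinAt

theorem jostAsymptotics_exp (n : ℕ) (k : ℝ) :
    JostAsymptotics (n := n) k (fun x => Complex.exp (Complex.I * k * x) • 1)
      (fun x => (Complex.I * k) • Complex.exp (Complex.I * k * x) • 1) := by
  constructor
  · refine tendsto_const_nhds.congr fun x => ?_
    rw [smul_smul, mul_comm, exp_mul_exp_neg, one_smul]
  · refine tendsto_const_nhds.congr fun x => ?_
    rw [smul_comm, smul_smul (Complex.exp _), mul_comm (Complex.exp _), exp_mul_exp_neg, one_smul]

/-- `Classical.epsilon` picks an unspecified Jost solution; uniqueness on the half line identifies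
it with the exponential. -/
theorem jostSolution_zero (hk : k ≠ 0) {x : ℝ} (hx : 0 ≤ x) :
    jostSolution (n := n) 0 k x = Complex.exp (Complex.I * k * x) • 1 ∧
      halfDeriv (jostSolution (n := n) 0 k) x =
        (Complex.I * k) • Complex.exp (Complex.I * k * x) • 1 := by
  have h0 : IntegrableOn (0 : ℝ → Matrix (Fin n) (Fin n) ℂ) (Ioi 0) := integrableOn_zero
  have hneg := solutionPair_exp n (-k)
  have hs : ((-k : ℝ) : ℂ) ^ 2 = (k : ℂ) ^ 2 := by push_cast; ring
  rw [hs] at hneg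
  exact jost_unique (fun x _ => by simp) hk (solutionPair_exp n k) (jostAsymptotics_exp n k)
    hneg (jostAsymptotics_exp n (-k)) (solutionPair_jostSolution h0 hk)
    (jostAsymptotics_jostSolution h0 hk) hx

/-- For `V = 0` the Jost solutions at `k` and `-k` are adjoint to each other. -/
theorem jostSolution_zero_conjTranspose (hk : k ≠ 0) {x : ℝ} (hx : 0 ≤ x) :
    (jostSolution (n := n) 0 k x)ᴴ = jostSolution 0 (-(k : ℂ)) x ∧
      (halfDeriv (jostSolution (n := n) 0 k) x)ᴴ =
        halfDeriv (jostSolution 0 (-(k : ℂ))) x := by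
  obtain ⟨h1, h2⟩ := jostSolution_zero (n := n) hk hx
  obtain ⟨h3, h4⟩ := jostSolution_zero (n := n) (neg_ne_zero.2 hk) hx
  have he : star (Complex.exp (Complex.I * k * x)) = Complex.exp (Complex.I * -(k : ℂ) * x) := by
    rw [← starRingEnd_apply, ← Complex.exp_conj]
    simp
  rw [Complex.ofReal_neg] at h3 h4
  rw [h1, h2, h3, h4]
  simp only [Matrix.conjTranspose_smul, Matrix.conjTranspose_one, he]
  simp

theorem jostMatrix_zero (hk : k ≠ 0) : jostMatrix 0 A B (k : ℂ) = B - (Complex.I * k) • A := by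
  obtain ⟨h1, h2⟩ := jostSolution_zero_conjTranspose (n := n) hk le_rfl
  obtain ⟨h3, h4⟩ := jostSolution_zero (n := n) hk le_rfl
  rw [jostMatrix_eq (V := 0) integrableOn_zero (fun x _ => by simp) hk, ← h1, ← h2, h3, h4]
  simp

end Free

/-! ### The Wronskian of the free and the perturbed physical solution. -/

section Scattering

variable {n : ℕ} {V : ℝ → Matrix (Fin n) (Fin n) ℂ} {A B : Matrix (Fin n) (Fin n) ℂ} {k : ℝ}

theorem integrableOn_physicalSolution_mul (hVi : IntegrableOn V (Ioi 0))
    (hV : ∀ x, 0 < x → (V x)ᴴ = V x) (hk : k ≠ 0) (hJ0 : IsUnit (jostMatrix 0 A B (k : ℂ)))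
    (hJ : IsUnit (jostMatrix V A B (k : ℂ))) :
    IntegrableOn (fun x => physicalSolution 0 A B k x * V x * physicalSolution V A B k x)
      (Ioi 0) := by
  have hV0 : ∀ x : ℝ, 0 < x →
      ((0 : ℝ → Matrix (Fin n) (Fin n) ℂ) x)ᴴ = (0 : ℝ → Matrix (Fin n) (Fin n) ℂ) x := by simp
  have h1 := (solutionPair_physicalSolution (V := 0) (A := A) (B := B) integrableOn_zero hV0
    hk).fst.continuousOn.mono Ioi_subset_Ici_self
  have h2 := (solutionPair_physicalSolution (A := A) (B := B) hVi hV
    hk).fst.continuousOn.mono Ioi_subset_Ici_self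
  obtain ⟨C, hC⟩ := exists_bound_physicalSolution integrableOn_zero hV0 hk hJ0
  obtain ⟨D, hD⟩ := exists_bound_physicalSolution hVi hV hk hJ
  refine Integrable.mul_bdd (c := D) (Integrable.bdd_mul (c := C) hVi
    (h1.aestronglyMeasurable measurableSet_Ioi) ?_)
    (h2.aestronglyMeasurable measurableSet_Ioi) ?_
  · exact (ae_restrict_mem measurableSet_Ioi).mono fun t ht => hC t (le_of_lt ht)
  · exact (ae_restrict_mem measurableSet_Ioi).mono fun t ht => hD t (le_of_lt ht)

/-- The Wronskian of the free and the perturbed physical solution vanishes at `0`. -/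
theorem wronskian_physicalSolution_zero (hVi : IntegrableOn V (Ioi 0))
    (hV : ∀ x, 0 < x → (V x)ᴴ = V x) (hk : k ≠ 0) (hJ0 : IsUnit (jostMatrix 0 A B (k : ℂ))) :
    physicalSolution 0 A B k 0 * physicalDeriv V A B k 0 -
      physicalDeriv 0 A B k 0 * physicalSolution V A B k 0 = 0 := by
  have hφ := isRegularSolution_regularSolution hVi hV hk A B
  have hφ0 := isRegularSolution_regularSolution (V := 0) integrableOn_zero (by simp) hk A B
  simp only [physicalSolution, physicalDeriv, hφ.apply_zero, hφ.deriv_zero, hφ0.apply_zero,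
    hφ0.deriv_zero]
  have hdet := (Matrix.isUnit_iff_isUnit_det _).1 hJ0
  have e1 := Matrix.mul_nonsing_inv _ hdet
  have e2 := Matrix.nonsing_inv_mul _ hdet
  have hB : B = jostMatrix 0 A B (k : ℂ) + (Complex.I * k) • A := by
    rw [jostMatrix_zero hk, sub_add_cancel]
  generalize jostMatrix 0 A B (k : ℂ) = P at *
  generalize (jostMatrix V A B (k : ℂ))⁻¹ = Q at *
  -- Substituting `B = P + ikA` turns both sides into `A + ik A P⁻¹ A`.
  have e3 : A * P⁻¹ * B = B * P⁻¹ * A := by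
    rw [hB, mul_add, add_mul, add_mul, mul_assoc A, e2, e1, mul_one, one_mul]
    simp only [mul_smul_comm, smul_mul_assoc]
  rw [smul_mul_smul_comm, smul_mul_smul_comm, ← mul_assoc, ← mul_assoc, e3, sub_self]

/-- Free Jost solutions are scalar and adjoint to each other at `±k`, so `ψ₀ = ½ (S₀ f₀(-k)† +
f₀(k)†)`. Against `ψ = ½ (f(k) S + f(-k))` this gives four Jost Wronskians: two tend to `0`, the
others to `-2ik` (beside `S₀`) and `2ik` (beside `S`). -/
theorem tendsto_wronskian_physicalSolution (hVi : IntegrableOn V (Ioi 0))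
    (hV : ∀ x, 0 < x → (V x)ᴴ = V x) (hk : k ≠ 0) (hJ0 : IsUnit (jostMatrix 0 A B (k : ℂ)))
    (hJ : IsUnit (jostMatrix V A B (k : ℂ))) :
    Tendsto (fun x => physicalSolution 0 A B k x * physicalDeriv V A B k x -
        physicalDeriv 0 A B k x * physicalSolution V A B k x) atTop
      (𝓝 ((Complex.I * k / 2) • (scatteringMatrix V A B k - scatteringMatrix 0 A B k))) := by
  have h0 : IntegrableOn (0 : ℝ → Matrix (Fin n) (Fin n) ℂ) (Ioi 0) := integrableOn_zero
  have af := jostAsymptotics_jostSolution hVi hk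
  have ag := jostAsymptotics_jostSolution_neg hVi hk
  have af0 := jostAsymptotics_jostSolution h0 hk
  have ag0 := jostAsymptotics_jostSolution_neg h0 hk
  have hψ := fun x (hx : 0 ≤ x) => physicalSolution_eq hVi hV hk hJ hx
  have hψ0 := fun x (hx : 0 ≤ x) => physicalSolution_eq (V := 0) h0 (by simp) hk hJ0 hx
  set S := scatteringMatrix V A B k
  set S0 := scatteringMatrix 0 A B k
  have hlim := ((((((ag0.wronskian_neg (by rw [neg_neg]; exact af)).const_mul S0).mul_const S).add
    ((ag0.wronskian_self ag).const_mul S0)).add ((af0.wronskian_self af).mul_const S)).add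
    (af0.wronskian_neg ag)).const_smul (4⁻¹ : ℂ)
  have e : (4⁻¹ : ℂ) • (S0 * 0 * S + S0 * ((2 * (Complex.I * ((-k : ℝ) : ℂ))) • 1) +
      (2 * (Complex.I * (k : ℂ))) • 1 * S + 0) = (Complex.I * k / 2) • (S - S0) := by
    simp only [mul_zero, zero_mul, zero_add, add_zero, mul_smul_comm, mul_one, smul_mul_assoc,
      one_mul, Complex.ofReal_neg]
    module
  rw [e] at hlim
  refine hlim.congr' ?_
  filter_upwards [eventually_ge_atTop 0] with x hx
  obtain ⟨p1, p2⟩ := hψ x hx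
  obtain ⟨q1, q2⟩ := hψ0 x hx
  obtain ⟨c1, c2⟩ := jostSolution_zero_conjTranspose (n := n) hk hx
  obtain ⟨d1, d2⟩ := jostSolution_zero (n := n) hk hx
  have comm1 : jostSolution 0 (k : ℂ) x * S0 = S0 * jostSolution 0 (k : ℂ) x := by
    rw [d1, smul_mul_assoc, mul_smul_comm, one_mul, mul_one]
  have comm2 : halfDeriv (jostSolution 0 (k : ℂ)) x * S0 =
      S0 * halfDeriv (jostSolution 0 (k : ℂ)) x := by
    rw [d2, smul_mul_assoc, smul_mul_assoc, mul_smul_comm, mul_smul_comm, one_mul, mul_one]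
  rw [p1, p2, q1, q2, comm1, comm2, ← c1, ← c2, Matrix.conjTranspose_conjTranspose,
    Matrix.conjTranspose_conjTranspose]
  simp only [smul_mul_smul_comm, ← smul_sub]
  congr 1
  · norm_num
  · noncomm_ring

end Scattering

end MatrixSchrodinger

/-! ### The integral formula for the scattering matrix. -/

open MatrixSchrodinger in
theorem proposition8p2 {n : ℕ} (V : ℝ → Matrix (Fin n) (Fin n) ℂ)
    (hV_int : IntegrableOn V (Ioi 0) volume)
    (hV_sa : ∀ x : ℝ, 0 < x → (V x)ᴴ = V x)
    (A B : Matrix (Fin n) (Fin n) ℂ)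
    (hAB : -(Bᴴ * A) + Aᴴ * B = 0)
    (hAB_pos : (Aᴴ * A + Bᴴ * B).PosDef)
    (k : ℝ) (hk : k ≠ 0) :
    IsUnit (jostMatrix 0 A B k) ∧
    IsUnit (jostMatrix V A B k) ∧
    IntegrableOn
      (fun x : ℝ => physicalSolution 0 A B k x * V x * physicalSolution V A B k x)
      (Ioi 0) volume ∧
    scatteringMatrix V A B k =
      scatteringMatrix 0 A B k -
        (2 * Complex.I / (k : ℂ)) •
          ∫ x in Ioi (0 : ℝ), physicalSolution 0 A B k x * V x * physicalSolution V A B k x := by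
  have hV0 : ∀ x : ℝ, 0 < x →
      ((0 : ℝ → Matrix (Fin n) (Fin n) ℂ) x)ᴴ = (0 : ℝ → Matrix (Fin n) (Fin n) ℂ) x := by simp
  have hJ0 := isUnit_jostMatrix (V := 0) integrableOn_zero hV0 hAB hAB_pos hk
  have hJ := isUnit_jostMatrix hV_int hV_sa hAB hAB_pos hk
  have hi := integrableOn_physicalSolution_mul hV_int hV_sa hk hJ0 hJ
  refine ⟨hJ0, hJ, hi, ?_⟩
  have hp := (solutionPair_physicalSolution (V := 0) (A := A) (B := B) integrableOn_zero hV0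
    hk).leftSolutionPair_of_zero.isPrimitive_wronskian
      (solutionPair_physicalSolution (A := A) (B := B) hV_int hV_sa hk)
  simp only [Pi.zero_apply, sub_zero] at hp
  -- The limit of the Wronskian at infinity is computed twice: as its value at `0` plus the integral
  -- of its density, and from the Jost asymptotics.
  have hlim := tendsto_nhds_unique (hp.tendsto hi)
    (tendsto_wronskian_physicalSolution hV_int hV_sa hk hJ0 hJ)
  rw [wronskian_physicalSolution_zero hV_int hV_sa hk hJ0, zero_add] at hlim
  have hk' : (k : ℂ) ≠ 0 := by exact_mod_cast hk
  rw [hlim, smul_smul, show 2 * Complex.I / (k : ℂ) * (Complex.I * k / 2) = -1 by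
    field_simp; exact Complex.I_sq]
  rw [neg_one_smul]
  abel
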